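/- **Cacti.** Let $S^1=\mathbb R/\mathbb Z$. For a finite nonempty set $I$, $\mathcal C(I)$ is the space of Voronov's cacti with lobes indexed by $I$ (so $\mathcal C(n)=\mathcal C(\{1,\dots,n\})$): tree-like configurations of parametrized circles (lobes) with radii $r_i>0$, $\sum r_i=1$, a distinguished point $0_i$ on each lobe, a cyclic ordering of the lobes at each intersection point, and a distinguished point $0$ on one of the lobes. A cactus $c$ is encoded by its traversal $f_c:S^1\to c$ from $0$, i.e. by the maps $f_i:S^1\to S^1$ ($i\in I$) obtained from $f_c$ by collapsing all lobes but the $i$-th, whose circumference is scaled to $1$ and whose point $0_i$ is $0\in S^1$. The families $(f_i)$ that occur are those for which there are monotone degree-one lifts $F_i$ and $r_i>0$, $\sum r_i=1$, with $\sum_i r_i(F_i(t)-F_i(s))=t-s$, and such that for $i\ne j$ there are points $p,q$ with $f_i(z)=p$ or $f_j(z)=q$ for every $z$. $\mathcal C(I)$ has the topology of uniform convergence of the $f_i$. Composition replaces the lobe $i$ by the cactus $d_i$ along $f_{d_i}$; the unit is the one-lobe cactus with $f=\mathrm{id}$; bijections of the index set relabel lobes. **Spiny cacti.** A spiny cactus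 is the combinatorial type of a pair $(c,X)$, where $X$ is a finite set of points of $c$ containing $0$, all $0_i$ and all intersection points. If $X$ has $j_k\ge1$ points on lobe $k$, it is the bijection $f$ from the pairs $(k,i)$, $0\le i<j_k$ (the $i$-th segment of lobe $k$, counted from $0_k$) to $\{0,\dots,\sum_k j_k-1\}$ (the positions in the traversal of $c$ from $0$); the bijections allowed are those that preserve the cyclic order on each lobe and for which different lobes do not cross. **Cactus sets.** A cactus set is a cyclic set $S_\bullet$ with maps $\mu_{c,X}:\prod_k S_{j_k-1}\to S_{\sum j_k-1}$, one for each spiny cactus, such that 1. if $(c',X')$ arises from $(c,X)$ by pinching the $i$-th segment of lobe $k$ (where $j_k\ge 2$), or by inserting a point in it, then $\mu_{c',X'}$ after the face, resp. degeneracy, with index $i$ in the factor $k$ equals the face, resp. degeneracy, with index $f(k,i)$ after $\mu_{c,X}$; 2. the $\mu_{c,X}$ are compatible with composition of spiny cacti; 3. the one-lobe spiny cacti with $0=0_1$ act as identities, and the $\mu_{c,X}$ are compatible with relabelling the lobes. **Proposition.** For every cactus set $S_\bullet$, the geometric realization $|S_\bullet|$ is, naturally in $S_\bullet$, an algebra over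 the topological (symmetric, unital) operad $\mathcal C$, where the action maps $\mathcal C(I)\times|S_\bullet|^I\to|S_\bullet|$ are continuous for the products of compactly generated spaces. The action is induced by the structure maps and the geometry of cacti, and it is the only family of maps with the following property. Let $c\in\mathcal C(I)$, let $s_k\in\Delta^{j_k-1}$ for $k\in I$, and let $s_k$ cut lobe $k$ (its circumference scaled to $1$), from $0_k$ on, into $j_k$ segments with the barycentric coordinates as lengths. Suppose that the dividing points $X$ include all intersection points and $0$, let $(c,X)$ be the resulting spiny cactus, and let $t\in\Delta^{\sum j_k-1}$ list the lengths of all segments in $c$ in the order of the traversal from $0$. Then for all $x_k\in S_{j_k-1}$, $c$ sends $([x_k,s_k])_k$ to $[\mu_{c,X}((x_k)_k),t]$. (Segments may have length $0$. By inserting degeneracies, every tuple of points of $|S_\bullet|$ can be written in this form.) -/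

import Mathlib

open CategoryTheory Simplicial
open scoped Topology

universe u

/-! ## Cacti

A cactus is recorded by its traversal `f : S¹ → c`. The cactus `c` is a tree-like union of `n`
circles, so collapsing all lobes but the `i`-th one is a retraction `c → S¹`, where the `i`-th lobe
is identified with the standard circle by its parametrization, with its distinguished point at `0`.
These collapses embed `c` into the torus `(S¹)ⁿ`, so that `f` is the `n`-tuple of the maps
`lobe i : S¹ → S¹`: "where on the `i`-th lobe are we at time `z`, all the other lobes being
collapsed". The traversal starts at time `0` at the distinguished point of the cactus, on the lobe
chosen for it; the cyclic orderings at the intersection points are the orders in which the lobes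
are visited. -/

/-- `IsCactus f` says that `f` is the traversal of a cactus with lobes indexed by `ι`:
there are positive radii with sum `1` such that each lobe is traversed once, monotonically,
and such that the traversal has unit speed for the length in which the `i`-th lobe has total
length `r i`; moreover any two lobes `i ≠ j` are separated: there are a point `p` of
lobe `i` and a point `q` of lobe `j` (the points at which the tree of lobes branches off towards
the other lobe) such that the traversal rests at `p` in lobe `i` whenever it is not at `q` in
lobe `j`. -/
structure IsCactus {ι : Type} [Fintype ι] (f : ι → C(UnitAddCircle, UnitAddCircle)) : Prop where
  metric : ∃ (r : ι → ℝ) (F : ι → CircleDeg1Lift),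
    (∀ i, 0 < r i) ∧ ∑ i, r i = 1 ∧
    (∀ i (t : ℝ), f i (t : UnitAddCircle) = ((F i t : ℝ) : UnitAddCircle)) ∧
    ∀ s t : ℝ, ∑ i, r i * (F i t - F i s) = t - s
  tree : ∀ i j, i ≠ j → ∃ p q : UnitAddCircle, ∀ z, f i z = p ∨ f j z = q

/-- The space of cacti whose lobes are indexed by the finite type `ι`; the arity `n` part of the
cactus operad is `Cactus (Fin n)`. There is no cactus without lobes. -/
def Cactus (ι : Type) [Fintype ι] : Type :=
  {f : ι → C(UnitAddCircle, UnitAddCircle) // IsCactus f}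

namespace Cactus

variable {ι κ : Type} [Fintype ι] [Fintype κ]

/-- The collapse onto the `i`-th lobe, precomposed with the traversal of the cactus. -/
def lobe (c : Cactus ι) (i : ι) : C(UnitAddCircle, UnitAddCircle) := c.1 i

/-- The topology of uniform convergence of the traversals. -/
instance : TopologicalSpace (Cactus ι) :=
  inferInstanceAs (TopologicalSpace {f : ι → C(UnitAddCircle, UnitAddCircle) // IsCactus f})

/-- The unit of the cactus operad: one circle, with all distinguished points at `0`. -/
def one : Cactus Unit :=
  ⟨fun _ => ContinuousMap.id _,
    { metric := ⟨fun _ => 1, fun _ => 1, by simp, by simp, by simp, by simp⟩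
      tree := fun i j h => absurd (Subsingleton.elim i j) h }⟩

/-- Relabelling of the lobes. -/
def reindex (c : Cactus κ) (σ : ι ≃ κ) : Cactus ι :=
  ⟨fun i => c.1 (σ i),
    { metric := by
        obtain ⟨r, F, h0, h1, h2, h3⟩ := c.2.metric
        refine ⟨r ∘ σ, F ∘ σ, fun i => h0 _, ?_, fun i t => h2 _ t, fun s t => ?_⟩
        · rw [← h1]
          exact σ.sum_comp r
        · rw [← h3 s t]
          exact σ.sum_comp (fun k => r k * (F k t - F k s))
      tree := fun i j h => c.2.tree _ _ (σ.injective.ne h) }⟩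

/-- Operad composition: the `i`-th lobe of `c` is collapsed onto the cactus `d i` along the
traversal of `d i`, the distinguished point of the lobe being sent to that of `d i`. -/
def comp {κ : ι → Type} [∀ i, Fintype (κ i)] (c : Cactus ι) (d : ∀ i, Cactus (κ i)) :
    Cactus (Σ i, κ i) :=
  ⟨fun p => ((d p.1).1 p.2).comp (c.1 p.1),
    { metric := by
        obtain ⟨r, F, h0, h1, h2, h3⟩ := c.2.metric
        choose ρ G g0 g1 g2 g3 using fun i => (d i).2.metric
        refine ⟨fun p => r p.1 * ρ p.1 p.2, fun p => G p.1 p.2 * F p.1,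
          fun p => mul_pos (h0 _) (g0 _ _), ?_, fun p t => ?_, fun s t => ?_⟩
        · simp [Fintype.sum_sigma, ← Finset.mul_sum, g1, h1]
        · simp [h2, g2]
        · simp [Fintype.sum_sigma, mul_assoc, ← Finset.mul_sum, g3, h3]
      tree := by
        rintro ⟨i, a⟩ ⟨j, b⟩ h
        by_cases hij : i = j
        · subst hij
          obtain ⟨p, q, hpq⟩ := (d i).2.tree a b (fun hab => h (by rw [hab]))
          exact ⟨p, q, fun z => hpq _⟩
        · obtain ⟨p, q, hpq⟩ := c.2.tree i j hij
          exact ⟨(d i).1 a p, (d j).1 b q, fun z => (hpq z).imp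
            (fun hz => congrArg ((d i).1 a) hz) (fun hz => congrArg ((d j).1 b) hz)⟩ }⟩

end Cactus

/-! ## Spiny cacti

A spiny cactus is an equivalence class of pairs `(c, X)`, where `X` is a finite set of points of
the cactus `c` that contains all distinguished points and all intersection points. Two pairs are
identified when their traversals differ by a reparametrization that matches all the data. So the
class is determined by the order in which the traversal of `c`, from `0` on, runs through the
segments into which `X` cuts the lobes, where the segments of each lobe are numbered in the order
of the lobe from its distinguished point on. -/

/-- `a`, `b`, `c` are distinct and in this cyclic order. -/
def CyclicLT {N : ℕ} (a b c : Fin N) : Prop :=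
  (a < b ∧ b < c) ∨ (b < c ∧ c < a) ∨ (c < a ∧ a < b)

/-- A spiny cactus with lobes indexed by `ι`, with `J k + 1` points (equivalently, segments) on
the lobe `k`, and with `m + 1` segments in total: `pos ⟨k, i⟩` is the position of the `i`-th segment
of lobe `k` in the traversal of the whole cactus. Each lobe is traversed in its cyclic order, and
the traversals of two different lobes do not cross. -/
structure SpinyCactus {ι : Type} (J : ι → ℕ) (m : ℕ) where
  pos : (Σ k, Fin (J k + 1)) ≃ Fin (m + 1)
  cyclic : ∀ k (a b c : Fin (J k + 1)), a < b → b < c →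
    CyclicLT (pos ⟨k, a⟩) (pos ⟨k, b⟩) (pos ⟨k, c⟩)
  noncrossing : ∀ k l, k ≠ l → ∀ (a a' : Fin (J k + 1)) (b b' : Fin (J l + 1)),
    ¬ (CyclicLT (pos ⟨k, a⟩) (pos ⟨l, b⟩) (pos ⟨k, a'⟩) ∧
      CyclicLT (pos ⟨k, a'⟩) (pos ⟨l, b'⟩) (pos ⟨k, a⟩))

namespace SpinyCactus

variable {ι κ : Type}

/-- The spiny cactus with one lobe, whose distinguished point is that of the whole cactus. -/
def one (m : ℕ) : SpinyCactus (fun _ : Unit => m) m where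
  pos := Equiv.uniqueSigma (fun _ : Unit => Fin (m + 1))
  cyclic := fun _ _ _ _ h h' => Or.inl ⟨h, h'⟩
  noncrossing := fun k l h => absurd (Subsingleton.elim k l) h

/-- Relabelling of the lobes. -/
def reindex {J : κ → ℕ} {m : ℕ} (e : SpinyCactus J m) (σ : ι ≃ κ) :
    SpinyCactus (fun i => J (σ i)) m where
  pos := (σ.sigmaCongrLeft (β := fun k => Fin (J k + 1))).trans e.pos
  cyclic := fun k => e.cyclic (σ k)
  noncrossing := fun _ _ h => e.noncrossing _ _ (σ.injective.ne h)

theorem cyclicLT_of {J : ι → ℕ} {m : ℕ} (e : SpinyCactus J m) (k : ι) {a b c : Fin (J k + 1)}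
    (h : CyclicLT a b c) : CyclicLT (e.pos ⟨k, a⟩) (e.pos ⟨k, b⟩) (e.pos ⟨k, c⟩) := by
  rcases h with ⟨h, h'⟩ | ⟨h, h'⟩ | ⟨h, h'⟩ <;> have := e.cyclic k _ _ _ h h' <;>
    unfold CyclicLT at * <;> tauto

theorem cyclicLT_iff {J : ι → ℕ} {m : ℕ} (e : SpinyCactus J m) (k : ι) {a b c : Fin (J k + 1)} :
    CyclicLT (e.pos ⟨k, a⟩) (e.pos ⟨k, b⟩) (e.pos ⟨k, c⟩) ↔ CyclicLT a b c := by
  refine ⟨fun h => ?_, e.cyclicLT_of k⟩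
  have ne : ∀ {x y : Fin (J k + 1)}, e.pos ⟨k, x⟩ ≠ e.pos ⟨k, y⟩ → x ≠ y := fun h e' => h (by rw [e'])
  have h1 : a ≠ b := ne (by unfold CyclicLT at h; intro h'; rw [h'] at h; omega)
  have h2 : b ≠ c := ne (by unfold CyclicLT at h; intro h'; rw [h'] at h; omega)
  have h3 : a ≠ c := ne (by unfold CyclicLT at h; intro h'; rw [h'] at h; omega)
  by_contra hn
  have := e.cyclicLT_of k (a := a) (b := c) (c := b) (by unfold CyclicLT at *; omega)
  unfold CyclicLT at *
  omega

/-- Composition of spiny cacti: the segments of the lobe `k` of `e` are the segments of `d k`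
in the order in which `d k` is traversed. -/
def comp {κ : ι → Type} {J : ι → ℕ} {m : ℕ} {R : ∀ k, κ k → ℕ} (e : SpinyCactus J m)
    (d : ∀ k, SpinyCactus (R k) (J k)) :
    SpinyCactus (fun p : Σ k, κ k => R p.1 p.2) m where
  pos := (Equiv.sigmaAssoc (fun k l => Fin (R k l + 1))).trans
    ((Equiv.sigmaCongrRight fun k => (d k).pos).trans e.pos)
  cyclic := fun p _ _ _ h h' => e.cyclicLT_of p.1 ((d p.1).cyclic p.2 _ _ _ h h')
  noncrossing := by
    rintro ⟨k, l⟩ ⟨k', l'⟩ h a a' b b'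
    by_cases hk : k = k'
    · subst hk
      have := (d k).noncrossing l l' (fun hl => h (by rw [hl])) a a' b b'
      rintro ⟨h1, h2⟩
      exact this ⟨(e.cyclicLT_iff k).1 h1, (e.cyclicLT_iff k).1 h2⟩
    · exact e.noncrossing k k' hk _ _ _ _

end SpinyCactus

/-! ## Cactus sets -/

/-- A cyclic set in the sense of Connes: a simplicial set with cyclic operators `τ`. The extra
degeneracy is `τ` after the last degeneracy. -/
structure CyclicSet where
  toSSet : SSet.{u}
  τ : ∀ n : ℕ, toSSet _⦋n⦌ → toSSet _⦋n⦌
  τ_iterate : ∀ n x, (τ n)^[n + 1] x = x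
  δ_zero_τ : ∀ n x, toSSet.δ 0 (τ (n + 1) x) = toSSet.δ (Fin.last (n + 1)) x
  δ_succ_τ : ∀ n (i : Fin (n + 1)) x, toSSet.δ i.succ (τ (n + 1) x) = τ n (toSSet.δ i.castSucc x)
  σ_zero_τ : ∀ n x, toSSet.σ 0 (τ n x) = τ (n + 1) (τ (n + 1) (toSSet.σ (Fin.last n) x))
  σ_succ_τ : ∀ n (i : Fin n) x, toSSet.σ i.succ (τ n x) = τ (n + 1) (toSSet.σ i.castSucc x)

/-- A cactus set: a cyclic set with a structure map `μ e` for each spiny cactus `e`.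

`μ_map` is the compatibility with faces and degeneracies. Suppose that `e'` arises from `e` by
pinching and subdividing segments: the `i`-th segment of the lobe `k` of `e'` is a part of the
`θ k i`-th segment of the lobe `k` of `e`, in the whole cactus its `a`-th segment is a part of the
`φ a`-th segment, and the parts of one segment are numbered in the same order on the lobe and on
the cactus. Then `μ` intertwines the operators `θ` and `φ`. If `φ` is the coface that omits the
position of the segment `i` of the lobe `k`, then `θ k` is the `i`-th coface, the other `θ l` are
identities, and `e'` is obtained from `e` by pinching this segment; likewise for codegeneracies and
the insertion of a new point in a segment. All the operators allowed here are composites of these.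

The other axioms are the compatibility with the operad structure: composition, unit, and
relabelling of the lobes. It is not demanded that the structure maps of the other spiny cacti with
one lobe (rotations) be the cyclic operators `τ`; cactus sets with this property are included. -/
structure CactusSet extends CyclicSet.{u} where
  μ : ∀ {ι : Type} {J : ι → ℕ} {m : ℕ}, SpinyCactus J m →
    (∀ k, toSSet _⦋J k⦌) → toSSet _⦋m⦌
  μ_map : ∀ {ι : Type} {J J' : ι → ℕ} {m m' : ℕ} (e : SpinyCactus J m) (e' : SpinyCactus J' m')
    (θ : ∀ k, ⦋J' k⦌ ⟶ ⦋J k⦌) (φ : ⦋m'⦌ ⟶ ⦋m⦌),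
    (∀ k i, φ (e'.pos ⟨k, i⟩) = e.pos ⟨k, θ k i⟩) →
    (∀ k i i', i < i' → θ k i = θ k i' → e'.pos ⟨k, i⟩ < e'.pos ⟨k, i'⟩) →
    ∀ x : ∀ k, toSSet _⦋J k⦌,
      μ e' (fun k => toSSet.map (θ k).op (x k)) = toSSet.map φ.op (μ e x)
  μ_comp : ∀ {ι : Type} {κ : ι → Type} {J : ι → ℕ} {m : ℕ} {R : ∀ k, κ k → ℕ}
    (e : SpinyCactus J m) (d : ∀ k, SpinyCactus (R k) (J k))
    (x : ∀ p : Σ k, κ k, toSSet _⦋R p.1 p.2⦌),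
    μ (e.comp d) x = μ e (fun k => μ (d k) (fun l => x ⟨k, l⟩))
  μ_one : ∀ {m : ℕ} (x : toSSet _⦋m⦌), μ (SpinyCactus.one m) (fun _ => x) = x
  μ_reindex : ∀ {ι κ : Type} {J : κ → ℕ} {m : ℕ} (e : SpinyCactus J m) (σ : ι ≃ κ)
    (x : ∀ k, toSSet _⦋J k⦌), μ (e.reindex σ) (fun i => x (σ i)) = μ e x

/-- A morphism of cactus sets: a map of cyclic sets that commutes with the structure maps. -/
structure CactusSet.Hom (S T : CactusSet.{u}) where
  map : S.toSSet ⟶ T.toSSet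
  map_τ : ∀ (n : ℕ) (x : S.toSSet _⦋n⦌), map.app _ (S.τ n x) = T.τ n (map.app _ x)
  map_μ : ∀ {ι : Type} {J : ι → ℕ} {m : ℕ} (e : SpinyCactus J m) (x : ∀ k, S.toSSet _⦋J k⦌),
    map.app _ (S.μ e x) = T.μ e (fun k => map.app _ (x k))

/-! ## Algebras over the cactus operad -/

/-- The structure of an algebra over the (topological, symmetric, unital) cactus operad on the
space `X`. Products of spaces are formed in compactly generated spaces, as is needed for
geometric realizations: the action is continuous for the compactly generated topology associated
with the product topology. -/
structure CactusAlgebra (X : Type u) [TopologicalSpace X] where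
  act : ∀ {ι : Type} [Fintype ι], Cactus ι → (ι → X) → X
  continuous_act : ∀ {ι : Type} [Fintype ι],
    Continuous[TopologicalSpace.compactlyGenerated.{u} (Cactus ι × (ι → X)), inferInstance]
      (fun p : Cactus ι × (ι → X) => act p.1 p.2)
  act_comp : ∀ {ι : Type} [Fintype ι] {κ : ι → Type} [∀ i, Fintype (κ i)] (c : Cactus ι)
    (d : ∀ i, Cactus (κ i)) (x : (Σ i, κ i) → X),
    act (c.comp d) x = act c (fun i => act (d i) (fun l => x ⟨i, l⟩))
  act_one : ∀ x : X, act Cactus.one (fun _ => x) = x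
  act_reindex : ∀ {ι κ : Type} [Fintype ι] [Fintype κ] (c : Cactus κ) (σ : ι ≃ κ) (x : κ → X),
    act (c.reindex σ) (fun i => x (σ i)) = act c x

/-! ## The action of a cactus in terms of simplices -/

/-- The point of the geometric realization of `S` represented by a simplex `x` of `S` and a
point `t` of the standard topological simplex. -/
noncomputable def realizationPoint (S : SSet.{u}) {n : ℕ} (x : S _⦋n⦌)
    (t : stdSimplex ℝ (Fin (n + 1))) : |S| :=
  SSet.toTop.map (SSet.yonedaEquiv.symm x) ((SimplexCategory.toTopHomeo ⦋n⦌).symm t)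

/-- A point `t` of the standard simplex cuts a circle of length `1`, from its base point on, into
segments of lengths `t 0, t 1, …`; this is the initial point of the `a`-th segment. -/
def cutPoint {n : ℕ} (t : stdSimplex ℝ (Fin (n + 1))) (a : Fin (n + 1)) : ℝ :=
  ∑ b ∈ Finset.Iio a, t b

/-- The relation between points `s k` and `t` of standard simplices that is given by the geometry
of the cactus `c`. The barycentric coordinates `s k` cut the lobe `k` of `c` (its length scaled to
`1`), from its distinguished point on, and `t` cuts the circle on which the traversal of `c` is
defined. The relation says that the traversal runs linearly through the `i`-th segment of the
lobe `k` on the segment number `e.pos ⟨k, i⟩` of the circle. So all distinguished points and all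
intersection points of `c` are among the dividing points `X`, the spiny cactus `e` is the class of
`(c, X)`, and `t` lists the lengths of all segments in the order of the traversal. (Segments
may have length `0`.) -/
def Cactus.Subdivides {ι : Type} [Fintype ι] {J : ι → ℕ} {m : ℕ} (c : Cactus ι)
    (e : SpinyCactus J m) (s : ∀ k, stdSimplex ℝ (Fin (J k + 1)))
    (t : stdSimplex ℝ (Fin (m + 1))) : Prop :=
  ∀ (k : ι) (i : Fin (J k + 1)), ∀ v ∈ Set.Icc (0 : ℝ) 1,
    c.lobe k ((cutPoint t (e.pos ⟨k, i⟩) + v * t (e.pos ⟨k, i⟩) : ℝ) : UnitAddCircle) =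
      ((cutPoint (s k) i + v * s k i : ℝ) : UnitAddCircle)

/-- `InducedByStructureMaps S a` says that the operations `a` on the realization of `S` are those
induced by the structure maps of `S` and the geometry of cacti: if the points `s k` cut the lobes
of `c` into the spiny cactus `e`, with the lengths `t`, then `c` sends the tuple of the points
`[x k, s k]` to `[μ e x, t]`. Degeneracies turn every tuple of points of the realization
into one of this form. -/
def InducedByStructureMaps (S : CactusSet.{u}) {ι : Type} [Fintype ι]
    (a : Cactus ι → (ι → |S.toSSet|) → |S.toSSet|) : Prop :=
  ∀ (c : Cactus ι) {J : ι → ℕ} {m : ℕ} (e : SpinyCactus J m)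
    (s : ∀ k, stdSimplex ℝ (Fin (J k + 1))) (t : stdSimplex ℝ (Fin (m + 1))),
    c.Subdivides e s t → ∀ x : ∀ k, S.toSSet _⦋J k⦌,
      a c (fun k => realizationPoint S.toSSet (x k) (s k)) =
        realizationPoint S.toSSet (S.μ e x) t

/-!
The proof rests on the description of a point `[x, s]` of the realization `|S|` by the subdivision
of the interval into segments of lengths `s 0, s 1, …`: two such points are equal if and only
if, on a common subdivision into segments of positive lengths, the two simplices become equal
(`map_segmentHom_eq`, `exists_common_subdivision`). Indeed, a sequence of points of `[0, 1)` sends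
`[x, s]` to the simplex that `x` induces on the segments containing these points, and this is
well-defined on `|S|` (`exists_simplexAt`).

*Existence of subdivisions.* A cactus `c` with lifts `F k` of its collapses to the real line rests
at a point `p` of a lobe during one arc of the circle. If a subdivision `t` of the circle contains
the endpoints of the arcs for the distinguished points of the lobes and for the points at which
lobes branch off, then the traversal moves on exactly one lobe during each segment, and there with
constant speed. This defines a spiny cactus that `c` subdivides; its lobes do not cross, because of
two lobes that are visited alternately one would be traversed more than once
(`Cactus.Lifts.exists_subdivides_of_adapted`, `Cactus.exists_subdivides`). The endpoints of further
arcs can be prescribed, so that the lobes are subdivided at prescribed points, and the number of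
points that are needed is bounded independently of `c`.

*Definition of the action.* Suppose that `c` is subdivided into a spiny cactus `e`. The segments of a
lobe account for a complete turn around it, so that the traversal rests on the lobe during all
the other segments. Hence a refinement of the subdivision is related to it by operators as in the
axiom `μ_map` (`Cactus.Subdivides.exists_position`), and the point `[μ e x, t]` does not change
under refinement. As any two subdivisions have a common refinement, it depends only on `c` and the
points `[x k, s k]` (`CactusSet.realizationPoint_μ_eq`). This defines the action and shows that it
is the only one induced by the structure maps. The algebra axioms and naturality then follow from
the axioms of cactus sets; for the composition `c.comp d` the subdivision of `c` is chosen so fine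
that it subdivides the cacti `d i` as well.

*Continuity.* The characteristic maps of `|S|` are closed, by the description of equality in `|S|`,
hence proper, and a compact subset of `|S|` lies in the union of finitely many closed cells
(`exists_finite_cells`). So a map from a compact space to `Cactus ι × (ι → |S|)` lifts to products
of simplices after a finite covering by closed maps. On a product of simplices there are, by the
bound above, only finitely many combinatorial types of subdivisions; each of them occurs over a
closed set, where the action is continuous.
-/

/-! ### Cutting the unit interval -/

section Cutting

variable {m n : ℕ}

theorem coe_injOn_Ico {x y : ℝ} (hx : x ∈ Set.Ico (0 : ℝ) 1) (hy : y ∈ Set.Ico (0 : ℝ) 1)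
    (h : (x : UnitAddCircle) = y) : x = y := by
  rwa [AddCircle.coe_eq_coe_iff_of_mem_Ico (a := 0)] at h <;> simpa using by assumption

theorem cutPoint_zero (t : stdSimplex ℝ (Fin (n + 1))) : cutPoint t 0 = 0 := by
  rw [cutPoint, show Finset.Iio (0 : Fin (n + 1)) = ∅ from Finset.Iio_bot, Finset.sum_empty]

theorem cutPoint_succ (t : stdSimplex ℝ (Fin (n + 1))) (i : Fin n) :
    cutPoint t i.succ = cutPoint t i.castSucc + t i.castSucc := by
  have : Finset.Iio i.succ = insert i.castSucc (Finset.Iio i.castSucc) := by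
    ext j
    simp only [Finset.mem_Iio, Finset.mem_insert, Fin.lt_def, Fin.ext_iff, Fin.val_succ,
      Fin.val_castSucc]
    omega
  rw [cutPoint, this, Finset.sum_insert (by simp), add_comm]
  rfl

theorem cutPoint_last_add (t : stdSimplex ℝ (Fin (n + 1))) :
    cutPoint t (Fin.last n) + t (Fin.last n) = 1 := by
  have : (Finset.univ : Finset (Fin (n + 1))) =
      insert (Fin.last n) (Finset.Iio (Fin.last n)) := by
    ext j
    simp only [Finset.mem_univ, Finset.mem_insert, Finset.mem_Iio, true_iff]
    exact (Fin.le_last j).eq_or_lt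
  rw [← stdSimplex.sum_eq_one t, this, Finset.sum_insert (by simp), add_comm]
  rfl

theorem cutPoint_add_le_cutPoint (t : stdSimplex ℝ (Fin (n + 1))) {a b : Fin (n + 1)}
    (h : a < b) : cutPoint t a + t a ≤ cutPoint t b := by
  rw [cutPoint, add_comm, ← Finset.sum_insert (by simp : a ∉ Finset.Iio a)]
  refine Finset.sum_le_sum_of_subset_of_nonneg (fun c hc => ?_) fun c _ _ => stdSimplex.zero_le t c
  simp only [Finset.mem_insert, Finset.mem_Iio] at hc ⊢
  rcases hc with rfl | hc
  exacts [h, hc.trans h]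

theorem cutPoint_nonneg (t : stdSimplex ℝ (Fin (n + 1))) (a : Fin (n + 1)) : 0 ≤ cutPoint t a :=
  Finset.sum_nonneg fun b _ => stdSimplex.zero_le t b

theorem cutPoint_mono (t : stdSimplex ℝ (Fin (n + 1))) : Monotone (cutPoint t) :=
  monotone_iff_forall_lt.2 fun a _ h =>
    (le_add_of_nonneg_right (stdSimplex.zero_le t a)).trans (cutPoint_add_le_cutPoint t h)

theorem cutPoint_add_le_one (t : stdSimplex ℝ (Fin (n + 1))) (a : Fin (n + 1)) :
    cutPoint t a + t a ≤ 1 := by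
  rcases (Fin.le_last a).eq_or_lt with rfl | h
  · exact (cutPoint_last_add t).le
  · refine (cutPoint_add_le_cutPoint t h).trans ?_
    rw [← cutPoint_last_add t]
    exact le_add_of_nonneg_right (stdSimplex.zero_le t _)

theorem cutPoint_le_one (t : stdSimplex ℝ (Fin (n + 1))) (a : Fin (n + 1)) : cutPoint t a ≤ 1 :=
  (le_add_of_nonneg_right (stdSimplex.zero_le t a)).trans (cutPoint_add_le_one t a)

theorem cutPoint_lt_one {t : stdSimplex ℝ (Fin (n + 1))} {a : Fin (n + 1)} (h : 0 < t a) :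
    cutPoint t a < 1 := by
  have := cutPoint_add_le_one t a
  linarith

theorem cutPoint_mem_Ico {t : stdSimplex ℝ (Fin (n + 1))} {a : Fin (n + 1)} (h : 0 < t a) :
    cutPoint t a ∈ Set.Ico (0 : ℝ) 1 :=
  ⟨cutPoint_nonneg t a, cutPoint_lt_one h⟩

theorem cutPoint_strictMono {t : stdSimplex ℝ (Fin (n + 1))} (h : ∀ a, 0 < t a) :
    StrictMono (cutPoint t) := fun a b hab => by
  have := cutPoint_add_le_cutPoint t hab
  linarith [h a]

/-- The end of a segment is, on the circle, the initial point of the next one in cyclic order. -/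
theorem coe_cutPoint_add_one (t : stdSimplex ℝ (Fin (n + 1))) (a : Fin (n + 1)) :
    ((cutPoint t (a + 1) : ℝ) : UnitAddCircle) = ((cutPoint t a + t a : ℝ) : UnitAddCircle) := by
  induction a using Fin.lastCases with
  | last =>
    rw [cutPoint_last_add, Fin.last_add_one, cutPoint_zero]
    exact (AddCircle.coe_period (1 : ℝ)).symm
  | cast i => rw [Fin.coeSucc_eq_succ, cutPoint_succ]

theorem sum_sub_cutPoint (t : stdSimplex ℝ (Fin (n + 1))) (h : ℝ → ℝ) :
    ∑ a, (h (cutPoint t a + t a) - h (cutPoint t a)) = h 1 - h 0 := by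
  rw [Finset.sum_sub_distrib, Fin.sum_univ_castSucc, Fin.sum_univ_succ (fun a => h (cutPoint t a)),
    cutPoint_last_add, cutPoint_zero]
  simp only [cutPoint_succ]
  ring

theorem cutPoint_injective : Function.Injective (cutPoint (n := n)) := by
  intro s t h
  ext a
  induction a using Fin.lastCases with
  | last => linarith [cutPoint_last_add s, cutPoint_last_add t, congrFun h (Fin.last n)]
  | cast i =>
    linarith [cutPoint_succ s i, cutPoint_succ t i, congrFun h i.succ, congrFun h i.castSucc]

@[fun_prop]
theorem continuous_cutPoint (a : Fin (n + 1)) :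
    Continuous fun t : stdSimplex ℝ (Fin (n + 1)) => cutPoint t a := by
  unfold cutPoint
  exact continuous_finsetSum _ fun b _ => (continuous_apply b).comp continuous_subtype_val

/-- The segment that contains the point `v ∈ [0, 1)`: of the segments that start at or before `v`
the last one. Segments of length `0` contain no point. -/
noncomputable def segmentAt (t : stdSimplex ℝ (Fin (n + 1))) : ℝ →o Fin (n + 1) where
  toFun v := (Finset.univ.filter fun a => cutPoint t a ≤ v).sup id
  monotone' v w h := Finset.sup_mono fun a ha => by
    rw [Finset.mem_filter] at ha ⊢
    exact ⟨ha.1, ha.2.trans h⟩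

theorem le_segmentAt {t : stdSimplex ℝ (Fin (n + 1))} {v : ℝ} {a : Fin (n + 1)}
    (h : cutPoint t a ≤ v) : a ≤ segmentAt t v :=
  Finset.le_sup (f := id) (Finset.mem_filter.2 ⟨Finset.mem_univ a, h⟩)

theorem cutPoint_segmentAt_le (t : stdSimplex ℝ (Fin (n + 1))) {v : ℝ} (hv : 0 ≤ v) :
    cutPoint t (segmentAt t v) ≤ v := by
  have h0 : (Finset.univ.filter fun a => cutPoint t a ≤ v).Nonempty :=
    ⟨0, Finset.mem_filter.2 ⟨Finset.mem_univ 0, (cutPoint_zero t).le.trans hv⟩⟩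
  obtain ⟨a, ha, h⟩ := Finset.exists_mem_eq_sup _ h0 id
  have : segmentAt t v = a := h
  rw [this]
  exact (Finset.mem_filter.1 ha).2

theorem lt_cutPoint_segmentAt_add (t : stdSimplex ℝ (Fin (n + 1))) {v : ℝ} (hv : v < 1) :
    v < cutPoint t (segmentAt t v) + t (segmentAt t v) := by
  by_contra! hc
  generalize ha : segmentAt t v = a at hc
  induction a using Fin.lastCases with
  | last => linarith [cutPoint_last_add t]
  | cast i =>
    rw [← cutPoint_succ] at hc
    have := le_segmentAt hc
    rw [ha] at this
    exact absurd this (by simp)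

theorem segmentAt_eq {t : stdSimplex ℝ (Fin (n + 1))} {v : ℝ} {a : Fin (n + 1)}
    (h1 : cutPoint t a ≤ v) (h2 : v < cutPoint t a + t a) : segmentAt t v = a := by
  have h0 := cutPoint_segmentAt_le t ((cutPoint_nonneg t a).trans h1)
  rcases lt_trichotomy (segmentAt t v) a with h | h | h
  · exact absurd (le_segmentAt h1) (not_le.2 h)
  · exact h
  · linarith [cutPoint_add_le_cutPoint t h]

theorem segmentAt_lt_iff (t : stdSimplex ℝ (Fin (n + 1))) {v : ℝ} (hv : 0 ≤ v)
    {a : Fin (n + 1)} : segmentAt t v < a ↔ v < cutPoint t a := by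
  constructor
  · intro h
    by_contra! hc
    exact absurd (le_segmentAt hc) (not_le.2 h)
  · intro h
    by_contra! hc
    linarith [cutPoint_mono t hc, cutPoint_segmentAt_le t hv]

theorem segmentAt_cutPoint {t : stdSimplex ℝ (Fin (n + 1))} {a : Fin (n + 1)} (h : 0 < t a) :
    segmentAt t (cutPoint t a) = a :=
  segmentAt_eq le_rfl (by linarith)

theorem cutPoint_map (f : Fin (m + 1) → Fin (n + 1)) (t : stdSimplex ℝ (Fin (m + 1)))
    (b : Fin (n + 1)) :
    cutPoint (stdSimplex.map f t) b = ∑ a with f a < b, t a := by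
  classical
  have h : ∀ c, (stdSimplex.map f t) c = ∑ a with f a = c, t a := fun c => by
    rw [stdSimplex.map_coe, FunOnFinite.linearMap_apply_apply]
  simp only [cutPoint, h]
  rw [← Finset.sum_fiberwise_of_maps_to (s := Finset.univ.filter fun a => f a < b)
    (t := Finset.Iio b) (g := f) (by simp)]
  refine Finset.sum_congr rfl fun c hc => Finset.sum_congr ?_ fun _ _ => rfl
  ext a
  simp only [Finset.mem_filter, Finset.mem_univ, true_and, Finset.mem_Iio] at hc ⊢
  exact ⟨fun h => ⟨h ▸ hc, h⟩, fun h => h.2⟩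

theorem segmentAt_map (f : Fin (m + 1) →o Fin (n + 1)) (t : stdSimplex ℝ (Fin (m + 1))) {v : ℝ}
    (hv : v ∈ Set.Ico (0 : ℝ) 1) :
    segmentAt (stdSimplex.map f t) v = f (segmentAt t v) := by
  set a := segmentAt t v with ha
  have h1 := cutPoint_segmentAt_le t hv.1
  have h2 := lt_cutPoint_segmentAt_add t hv.2
  rw [← ha] at h1 h2
  refine segmentAt_eq (le_trans ?_ h1) (lt_of_lt_of_le h2 ?_)
  · rw [cutPoint_map, cutPoint]
    refine Finset.sum_le_sum_of_subset_of_nonneg (fun b hb => ?_)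
      fun b _ _ => stdSimplex.zero_le t b
    simp only [Finset.mem_filter, Finset.mem_univ, true_and, Finset.mem_Iio] at hb ⊢
    exact f.monotone.reflect_lt hb
  · rw [cutPoint_map, stdSimplex.map_coe, FunOnFinite.linearMap_apply_apply, cutPoint, add_comm,
      ← Finset.sum_insert (by simp : a ∉ Finset.Iio a), ← Finset.sum_union]
    · refine Finset.sum_le_sum_of_subset_of_nonneg (fun b hb => ?_)
        fun b _ _ => stdSimplex.zero_le t b
      simp only [Finset.mem_insert, Finset.mem_Iio, Finset.mem_union, Finset.mem_filter,
        Finset.mem_univ, true_and] at hb ⊢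
      have : b ≤ a := hb.elim (fun h => h.le) le_of_lt
      exact (f.monotone this).lt_or_eq
    · rw [Finset.disjoint_filter]
      exact fun b _ h h' => h.ne h'

/-- The operator that sends the `i`-th vertex to the segment of `t` that contains `v i`. -/
noncomputable def segmentHom {p : ℕ} (t : stdSimplex ℝ (Fin (n + 1))) (v : Fin (p + 1) →o ℝ) :
    ⦋p⦌ ⟶ ⦋n⦌ :=
  SimplexCategory.mkHom ((segmentAt t).comp v)

/-- The initial points of all segments. -/
noncomputable def cutPoints (t : stdSimplex ℝ (Fin (n + 1))) : Fin (n + 1) →o ℝ :=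
  ⟨cutPoint t, cutPoint_mono t⟩

/-- `t.IsCut z`: the subdivision `t` of the circle has `z` among its dividing points. -/
def IsCut (t : stdSimplex ℝ (Fin (n + 1))) (z : UnitAddCircle) : Prop :=
  ∃ a, ((cutPoint t a : ℝ) : UnitAddCircle) = z

/-- If `t` is a subdivision into segments of positive lengths that is finer than `s`, then `s`
is the image of `t` under the operator that sends each segment of `t` to the segment of `s` that
contains it. -/
theorem map_segmentHom_cutPoints {s : stdSimplex ℝ (Fin (n + 1))} {t : stdSimplex ℝ (Fin (m + 1))}
    (ht : ∀ a, 0 < t a) (h : ∀ a, IsCut t (cutPoint s a : ℝ)) :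
    stdSimplex.map (segmentHom s (cutPoints t)) t = s := by
  apply cutPoint_injective
  ext a
  rw [cutPoint_map]
  have h1 : ∀ b, segmentHom s (cutPoints t) b < a ↔ cutPoint t b < cutPoint s a := fun b =>
    segmentAt_lt_iff s (cutPoint_nonneg t b)
  simp only [h1]
  rcases (cutPoint_le_one s a).eq_or_lt with h2 | h2
  · rw [h2, Finset.filter_true_of_mem fun b _ => cutPoint_lt_one (ht b), stdSimplex.sum_eq_one]
  · obtain ⟨b, hb⟩ := h a
    rw [← coe_injOn_Ico (cutPoint_mem_Ico (ht b)) ⟨cutPoint_nonneg s a, h2⟩ hb, cutPoint]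
    refine Finset.sum_congr ?_ fun _ _ => rfl
    ext c
    simp only [Finset.mem_filter, Finset.mem_univ, true_and, Finset.mem_Iio]
    exact (cutPoint_strictMono ht).lt_iff_lt

/-- A strictly increasing sequence in `[0, 1)` that starts at `0` cuts the unit interval into
segments of positive lengths. -/
theorem exists_cutPoint_eq (g : Fin (n + 1) → ℝ) (hg : StrictMono g) (h0 : g 0 = 0)
    (h1 : ∀ a, g a < 1) :
    ∃ t : stdSimplex ℝ (Fin (n + 1)), (∀ a, 0 < t a) ∧ cutPoint t = g := by
  let G : Fin (n + 2) → ℝ := Fin.snoc g 1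
  have hGc : ∀ a : Fin (n + 1), G a.castSucc = g a := fun a => Fin.snoc_castSucc ..
  have hGl : G (Fin.last (n + 1)) = 1 := Fin.snoc_last ..
  have hGs : ∀ i : Fin n, G i.castSucc.succ = g i.succ := fun i =>
    (congrArg G (Fin.succ_castSucc i)).trans (hGc _)
  have hG : ∀ a : Fin (n + 1), G a.castSucc < G a.succ := fun a => by
    rw [hGc]
    induction a using Fin.lastCases with
    | last => rw [Fin.succ_last, hGl]; exact h1 _
    | cast i => rw [hGs]; exact hg Fin.castSucc_lt_succ
  have hsum : ∑ a : Fin (n + 1), (G a.succ - G a.castSucc) = 1 := by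
    have e1 := Fin.sum_univ_succ G
    rw [Fin.sum_univ_castSucc G] at e1
    have e3 : G 0 = 0 := (hGc 0).trans h0
    rw [Finset.sum_sub_distrib]
    linarith
  let t : stdSimplex ℝ (Fin (n + 1)) :=
    ⟨fun a => G a.succ - G a.castSucc, fun a => (sub_pos.2 (hG a)).le, hsum⟩
  refine ⟨t, fun a => sub_pos.2 (hG a), ?_⟩
  ext a
  induction a using Fin.induction with
  | zero => rw [cutPoint_zero, h0]
  | succ i ih =>
    rw [cutPoint_succ, ih]
    change _ + (G i.castSucc.succ - G i.castSucc.castSucc) = _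
    rw [hGs, hGc]
    ring

/-- Finitely many points of the circle are dividing points of a subdivision into segments of
positive lengths. -/
theorem exists_isCut (B : Finset UnitAddCircle) :
    ∃ (m : ℕ) (t : stdSimplex ℝ (Fin (m + 1))), m ≤ B.card ∧ (∀ a, 0 < t a) ∧
      ∀ z ∈ B, IsCut t z := by
  classical
  let ρ : UnitAddCircle → ℝ := fun z => (AddCircle.equivIco (1 : ℝ) 0 z : ℝ)
  have hρ : ∀ z, ρ z ∈ Set.Ico (0 : ℝ) 1 := fun z => by
    simpa using (AddCircle.equivIco (1 : ℝ) 0 z).2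
  let A : Finset ℝ := insert 0 (B.image ρ)
  have hA : ∀ v ∈ A, v ∈ Set.Ico (0 : ℝ) 1 := fun v hv => by
    rcases Finset.mem_insert.1 hv with rfl | hv
    · simp
    · obtain ⟨z, -, rfl⟩ := Finset.mem_image.1 hv
      exact hρ z
  obtain ⟨m, hm⟩ : ∃ m, A.card = m + 1 :=
    Nat.exists_eq_add_one.2 (Finset.card_pos.2 ⟨0, Finset.mem_insert_self _ _⟩)
  have hm' : m ≤ B.card := by
    have h1 := Finset.card_insert_le 0 (B.image ρ)
    have h2 : (B.image ρ).card ≤ B.card := Finset.card_image_le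
    change A.card ≤ _ at h1
    omega
  let g := A.orderEmbOfFin hm
  have hg0 : g 0 = 0 := by
    have h1 : (0 : ℝ) ∈ Set.range g := by
      rw [Finset.range_orderEmbOfFin]
      exact Finset.mem_insert_self _ _
    obtain ⟨a, ha⟩ := h1
    refine le_antisymm ?_ (hA _ (Finset.orderEmbOfFin_mem A hm 0)).1
    rw [← ha]
    exact g.monotone (Fin.zero_le a)
  obtain ⟨t, ht, htg⟩ := exists_cutPoint_eq g g.strictMono hg0
    fun a => (hA _ (Finset.orderEmbOfFin_mem A hm a)).2
  refine ⟨m, t, hm', ht, fun z hz => ?_⟩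
  have h1 : ρ z ∈ Set.range g := by
    rw [Finset.range_orderEmbOfFin]
    exact Finset.mem_insert_of_mem (Finset.mem_image_of_mem ρ hz)
  obtain ⟨a, ha⟩ := h1
  refine ⟨a, ?_⟩
  rw [htg, ha]
  exact (AddCircle.equivIco (1 : ℝ) 0).symm_apply_apply z

end Cutting

/-! ### Points of the geometric realization -/

theorem realizationPoint_map (S : SSet.{u}) {m n : ℕ} (θ : ⦋m⦌ ⟶ ⦋n⦌) (x : S _⦋n⦌)
    (s : stdSimplex ℝ (Fin (m + 1))) :
    realizationPoint S (S.map θ.op x) s = realizationPoint S x (stdSimplex.map θ s) := by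
  unfold realizationPoint
  have := SimplexCategory.toTopHomeo_symm_naturality_apply.{u} θ s
  erw [this, ← SSet.yonedaEquiv_symm_naturality_left θ x]
  rw [Functor.map_comp]
  rfl

theorem toTop_map_realizationPoint {S T : SSet.{u}} (f : S ⟶ T) {n : ℕ} (x : S _⦋n⦌)
    (s : stdSimplex ℝ (Fin (n + 1))) :
    SSet.toTop.map f (realizationPoint S x s) = realizationPoint T (f.app _ x) s := by
  unfold realizationPoint
  have : SSet.yonedaEquiv.symm (f.app _ x) = SSet.yonedaEquiv.symm x ≫ f := by
    apply SSet.yonedaEquiv.injective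
    rw [SSet.yonedaEquiv_comp]
    simp
  rw [this, Functor.map_comp]
  rfl

@[fun_prop]
theorem continuous_realizationPoint (S : SSet.{u}) {n : ℕ} (x : S _⦋n⦌) :
    Continuous (realizationPoint S x) := by
  unfold realizationPoint
  fun_prop

/-- The universal property of the realization: compatible continuous maps from the simplices to
`Y` glue to a map from the realization. -/
theorem exists_hom_realizationPoint (S : SSet.{u}) (Y : TopCat.{u})
    (g : ∀ n : ℕ, S _⦋n⦌ → C(stdSimplex ℝ (Fin (n + 1)), Y))
    (hg : ∀ {m n : ℕ} (θ : ⦋m⦌ ⟶ ⦋n⦌) (x : S _⦋n⦌) (s : stdSimplex ℝ (Fin (m + 1))),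
      g m (S.map θ.op x) s = g n x (stdSimplex.map θ s)) :
    ∃ h : |S| ⟶ Y, ∀ (n : ℕ) (x : S _⦋n⦌) (s : stdSimplex ℝ (Fin (n + 1))),
      h (realizationPoint S x s) = g n x s := by
  let G : S ⟶ TopCat.toSSet.obj Y :=
    { app := fun n => TypeCat.ofHom fun x => (Y.toSSetObjEquiv n).symm (g n.unop.len x)
      naturality := by
        intro n m f
        ext x
        apply (Y.toSSetObjEquiv m).injective
        ext s
        exact hg f.unop x s }
  refine ⟨(sSetTopAdj.homEquiv _ _).symm G, fun n x s => ?_⟩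
  set h := (sSetTopAdj.homEquiv _ _).symm G with hh
  have h1 : sSetTopAdj.unit.app S ≫ TopCat.toSSet.map h = G := by
    rw [← sSetTopAdj.homEquiv_unit S Y h, hh, Equiv.apply_symm_apply]
  have h2 : ((sSetTopAdj.unit.app S ≫ TopCat.toSSet.map h).app (Opposite.op ⦋n⦌) x).down =
      (G.app (Opposite.op ⦋n⦌) x).down := by rw [h1]
  have h3 := ConcreteCategory.congr_hom h2 (ULift.up s)
  have h4 : ((sSetTopAdj.unit.app S ≫ TopCat.toSSet.map h).app (Opposite.op ⦋n⦌) x).down =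
      ((sSetTopAdj.unit.app S).app _ x).down ≫ h := rfl
  rw [h4, sSetTopAdj_unit_app_app_down] at h3
  exact h3

theorem hom_ext_realizationPoint {S : SSet.{u}} {Y : TopCat.{u}} {f g : |S| ⟶ Y}
    (h : ∀ (n : ℕ) (x : S _⦋n⦌) (s : stdSimplex ℝ (Fin (n + 1))),
      f (realizationPoint S x s) = g (realizationPoint S x s)) : f = g := by
  apply (sSetTopAdj.homEquiv _ _).injective
  rw [sSetTopAdj.homEquiv_unit, sSetTopAdj.homEquiv_unit]
  ext n x
  apply ULift.down_injective
  have h4 : ∀ k : |S| ⟶ Y, ((sSetTopAdj.unit.app S ≫ TopCat.toSSet.map k).app n x).down =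
      ((sSetTopAdj.unit.app S).app _ x).down ≫ k := fun _ => rfl
  refine (h4 f).trans (Eq.trans ?_ (h4 g).symm)
  rw [sSetTopAdj_unit_app_app_down]
  refine ConcreteCategory.hom_ext _ _ fun s => ?_
  exact h n.unop.len x s.down

/-- The points represented by simplices are the whole realization, because two maps from the
realization that agree at these points are equal. -/
theorem exists_eq_realizationPoint {S : SSet.{u}} (p : |S|) :
    ∃ (n : ℕ) (x : S _⦋n⦌) (s : stdSimplex ℝ (Fin (n + 1))), p = realizationPoint S x s := by
  -- With the indiscrete topology on the target, the predicate in question is a continuous map.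
  let Y : TopCat.{u} := @TopCat.of (ULift.{u} Prop) ⊤
  let f : |S| ⟶ Y := @TopCat.ofHom _ _ _ ⊤
    (@ContinuousMap.mk _ _ _ ⊤ (fun q => ULift.up (∃ (n : ℕ) (x : S _⦋n⦌)
      (s : stdSimplex ℝ (Fin (n + 1))), q = realizationPoint S x s)) continuous_top)
  let g : |S| ⟶ Y := @TopCat.ofHom _ _ _ ⊤
    (@ContinuousMap.mk _ _ _ ⊤ (fun _ => ULift.up True) continuous_top)
  have hfg : f = g := by
    apply hom_ext_realizationPoint
    intro n x s
    apply ULift.down_injective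
    exact eq_true ⟨n, x, s, rfl⟩
  have := congrArg ULift.down (ConcreteCategory.congr_hom hfg p)
  exact of_eq_true this

/-- A function on the realization with values in a type `Y` in the same universe can be defined
on simplices: this is the universal property for the indiscrete topology on `Y`. -/
theorem exists_fun_realizationPoint (S : SSet.{u}) (Y : Type u)
    (g : ∀ n : ℕ, S _⦋n⦌ → stdSimplex ℝ (Fin (n + 1)) → Y)
    (hg : ∀ {m n : ℕ} (θ : ⦋m⦌ ⟶ ⦋n⦌) (x : S _⦋n⦌) (s : stdSimplex ℝ (Fin (m + 1))),
      g m (S.map θ.op x) s = g n x (stdSimplex.map θ s)) :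
    ∃ h : |S| → Y, ∀ (n : ℕ) (x : S _⦋n⦌) (s : stdSimplex ℝ (Fin (n + 1))),
      h (realizationPoint S x s) = g n x s := by
  obtain ⟨h, hh⟩ := exists_hom_realizationPoint S (@TopCat.of Y ⊤)
    (fun n x => @ContinuousMap.mk _ _ _ ⊤ (g n x) continuous_top) hg
  exact ⟨fun p => h p, hh⟩

/-- The realization has the final topology with respect to the characteristic maps. -/
theorem isClosed_of_realizationPoint {S : SSet.{u}} {C : Set |S|}
    (h : ∀ (n : ℕ) (x : S _⦋n⦌), IsClosed (realizationPoint S x ⁻¹' C)) : IsClosed C := by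
  let Z : TopCat.{u} := @TopCat.of |S| (⨆ p : Σ n : ℕ, S _⦋n⦌,
    TopologicalSpace.coinduced (realizationPoint S p.2) inferInstance)
  have hZ : ∀ (n : ℕ) (x : S _⦋n⦌), Continuous[_, Z.str] (realizationPoint S x) := fun n x =>
    continuous_iff_coinduced_le.2
      (le_iSup (fun p : Σ n : ℕ, S _⦋n⦌ =>
        TopologicalSpace.coinduced (realizationPoint S p.2) inferInstance) ⟨n, x⟩)
  obtain ⟨k, hk⟩ := exists_hom_realizationPoint S Z
    (fun n x => @ContinuousMap.mk _ _ _ Z.str (realizationPoint S x) (hZ n x))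
    (fun θ x s => realizationPoint_map S θ x s)
  have hid : ∀ p, k p = p := fun p => by
    obtain ⟨n, x, s, rfl⟩ := exists_eq_realizationPoint p
    exact hk n x s
  have hC : IsClosed[Z.str] C :=
    isClosed_iSup_iff.2 fun p => isClosed_coinduced.2 (h p.1 p.2)
  have h5 : IsClosed ((fun p => k p) ⁻¹' C) :=
    @IsClosed.preimage |S| Z _ Z.str _ k.hom.continuous C hC
  have hk' : (fun p => k p) = id := funext hid
  rw [hk'] at h5
  exact h5

/-- A point of the realization of `S` can be regarded as a map to `S` from the nerve of the linear
order `[0, 1)`: the point `[x, s]` sends the points `v 0 ≤ … ≤ v p` to the simplex of `S` that `x`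
induces on the segments of `s` in which the points `v i` lie. -/
theorem exists_simplexAt (S : SSet.{u}) {p : ℕ} (v : Fin (p + 1) →o ℝ)
    (hv : ∀ i, v i ∈ Set.Ico (0 : ℝ) 1) :
    ∃ h : |S| → S _⦋p⦌, ∀ (n : ℕ) (x : S _⦋n⦌) (s : stdSimplex ℝ (Fin (n + 1))),
      h (realizationPoint S x s) = S.map (segmentHom s v).op x := by
  refine exists_fun_realizationPoint S _ (fun n x s => S.map (segmentHom s v).op x) ?_
  intro m n θ x s
  have : segmentHom (stdSimplex.map θ s) v = segmentHom s v ≫ θ := by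
    ext i : 3
    exact segmentAt_map θ.toOrderHom s (hv i)
  rw [this, op_comp, Functor.map_comp]
  rfl

/-- If two points of simplices represent the same point of the realization, then the simplices
agree on every common subdivision into segments of positive lengths. -/
theorem map_segmentHom_eq {S : SSet.{u}} {m n p : ℕ} {x : S _⦋m⦌} {y : S _⦋n⦌}
    {s : stdSimplex ℝ (Fin (m + 1))} {t : stdSimplex ℝ (Fin (n + 1))}
    (h : realizationPoint S x s = realizationPoint S y t) {w : stdSimplex ℝ (Fin (p + 1))}
    (hw : ∀ a, 0 < w a) :
    S.map (segmentHom s (cutPoints w)).op x = S.map (segmentHom t (cutPoints w)).op y := by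
  obtain ⟨k, hk⟩ := exists_simplexAt S (cutPoints w) fun i => cutPoint_mem_Ico (hw i)
  rw [← hk, ← hk, h]

instance {m n : ℕ} : Finite (⦋m⦌ ⟶ ⦋n⦌) :=
  Finite.of_injective (fun θ : ⦋m⦌ ⟶ ⦋n⦌ => (θ : Fin (m + 1) → Fin (n + 1))) fun θ θ' h => by
    ext i : 3
    exact congrFun h i

/-- Two points of simplices represent the same point of the realization only if they are
images of one point of a simplex of bounded dimension, at which the two simplices agree. -/
theorem exists_common_subdivision {S : SSet.{u}} {m n : ℕ} {x : S _⦋m⦌} {y : S _⦋n⦌}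
    {s : stdSimplex ℝ (Fin (m + 1))} {t : stdSimplex ℝ (Fin (n + 1))}
    (h : realizationPoint S x s = realizationPoint S y t) :
    ∃ p < m + n + 3, ∃ (α : ⦋p⦌ ⟶ ⦋m⦌) (β : ⦋p⦌ ⟶ ⦋n⦌) (w : stdSimplex ℝ (Fin (p + 1))),
      stdSimplex.map α w = s ∧ stdSimplex.map β w = t ∧ S.map α.op x = S.map β.op y := by
  classical
  obtain ⟨p, w, hp, hw, hc⟩ := exists_isCut
    (Finset.univ.image (fun a => ((cutPoint s a : ℝ) : UnitAddCircle)) ∪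
      Finset.univ.image (fun a => ((cutPoint t a : ℝ) : UnitAddCircle)))
  refine ⟨p, ?_, segmentHom s (cutPoints w), segmentHom t (cutPoints w), w,
    map_segmentHom_cutPoints hw fun a => hc _ ?_, map_segmentHom_cutPoints hw fun a => hc _ ?_,
    map_segmentHom_eq h hw⟩
  · have h1 := (Finset.card_union_le _ _).trans (add_le_add
      (Finset.card_image_le (s := Finset.univ) (f := fun a => ((cutPoint s a : ℝ) : UnitAddCircle)))
      (Finset.card_image_le (s := Finset.univ)
        (f := fun a => ((cutPoint t a : ℝ) : UnitAddCircle))))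
    simp only [Finset.card_univ, Fintype.card_fin] at h1
    omega
  · exact Finset.mem_union_left _ (Finset.mem_image_of_mem _ (Finset.mem_univ a))
  · exact Finset.mem_union_right _ (Finset.mem_image_of_mem _ (Finset.mem_univ a))

instance (n : ℕ) : CompactSpace (stdSimplex ℝ (Fin (n + 1))) :=
  isCompact_iff_compactSpace.1 (isCompact_stdSimplex ℝ (Fin (n + 1)))

/-- The preimage in another simplex of the image of a closed set `C` is the union, over the finitely
many possible types of common subdivisions, of images of preimages of `C` under affine maps. -/
theorem isClosedMap_realizationPoint (S : SSet.{u}) {n : ℕ} (y : S _⦋n⦌) :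
    IsClosedMap (realizationPoint S y) := by
  intro C hC
  refine isClosed_of_realizationPoint fun m x => ?_
  have : realizationPoint S x ⁻¹' (realizationPoint S y '' C) =
      ⋃ (p : Fin (m + n + 3)) (α : ⦋(p : ℕ)⦌ ⟶ ⦋m⦌) (β : ⦋(p : ℕ)⦌ ⟶ ⦋n⦌)
        (_ : S.map α.op x = S.map β.op y),
        stdSimplex.map α '' (stdSimplex.map (S := ℝ) β ⁻¹' C) := by
    ext s
    simp only [Set.mem_preimage, Set.mem_image, Set.mem_iUnion]
    constructor
    · rintro ⟨t, ht, h⟩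
      obtain ⟨p, hp, α, β, w, rfl, rfl, hxy⟩ := exists_common_subdivision h.symm
      exact ⟨⟨p, hp⟩, α, β, hxy, w, ht, rfl⟩
    · rintro ⟨p, α, β, hxy, w, hw, rfl⟩
      refine ⟨_, hw, ?_⟩
      rw [← realizationPoint_map, ← realizationPoint_map, hxy]
  rw [this]
  refine isClosed_iUnion_of_finite fun p => isClosed_iUnion_of_finite fun α =>
    isClosed_iUnion_of_finite fun β => isClosed_iUnion_of_finite fun _ => ?_
  exact (stdSimplex.continuous_map _).isClosedMap _ (hC.preimage (stdSimplex.continuous_map _))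

theorem isProperMap_realizationPoint (S : SSet.{u}) {n : ℕ} (y : S _⦋n⦌) :
    IsProperMap (realizationPoint S y) := by
  refine isProperMap_iff_isClosedMap_and_compact_fibers.2
    ⟨continuous_realizationPoint S y, isClosedMap_realizationPoint S y, fun p => ?_⟩
  obtain ⟨m, x, s, rfl⟩ := exists_eq_realizationPoint p
  have := isClosedMap_realizationPoint S x _ (isClosed_singleton (x := s))
  rw [Set.image_singleton] at this
  exact (this.preimage (continuous_realizationPoint S y)).isCompact

/-- Every point of a simplex is an interior point of a face. -/
theorem exists_pos_face {n : ℕ} (s : stdSimplex ℝ (Fin (n + 1))) :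
    ∃ p < n + 3, ∃ (α : ⦋p⦌ ⟶ ⦋n⦌) (w : stdSimplex ℝ (Fin (p + 1))), (∀ a, 0 < w a) ∧
      stdSimplex.map α w = s := by
  classical
  obtain ⟨p, w, hp, hw, hc⟩ := exists_isCut
    (Finset.univ.image (fun a => ((cutPoint s a : ℝ) : UnitAddCircle)))
  refine ⟨p, ?_, segmentHom s (cutPoints w), w, hw, map_segmentHom_cutPoints hw fun a => hc _ ?_⟩
  · have h1 := Finset.card_image_le (s := Finset.univ)
      (f := fun a => ((cutPoint s a : ℝ) : UnitAddCircle))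
    simp only [Finset.card_univ, Fintype.card_fin] at h1
    omega
  · exact Finset.mem_image_of_mem _ (Finset.mem_univ a)

/-- A compact subset of the realization lies in the union of finitely many closed cells. Otherwise
there is a sequence of points in it none of which lies in a closed cell chosen for an earlier one.
Every closed cell contains only finitely many points of the sequence, so that all subsets of
the sequence are closed, which is impossible in a compact space. -/
theorem exists_finite_cells {S : SSet.{u}} {Q : Set |S|} (hQ : IsCompact Q) :
    ∃ A : Finset (Σ n : ℕ, S _⦋n⦌), ∀ q ∈ Q, ∃ y ∈ A, q ∈ Set.range (realizationPoint S y.2) := by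
  classical
  by_contra! hcon
  choose dim face coord hrep using fun p : |S| => exists_eq_realizationPoint p
  let cell : |S| → Σ n : ℕ, S _⦋n⦌ := fun q => ⟨dim q, face q⟩
  have hcell : ∀ q, q ∈ Set.range (realizationPoint S (cell q).2) := fun q =>
    ⟨coord q, (hrep q).symm⟩
  obtain ⟨q, hqQ, hq⟩ : ∃ q : ℕ → |S|, (∀ i, q i ∈ Q) ∧
      ∀ i j, i < j → q j ∉ Set.range (realizationPoint S (cell (q i)).2) := by
    obtain ⟨q, hq⟩ := exists_seq_of_forall_finset_exists (fun q => q ∈ Q)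
      (fun a b : |S| => b ∉ Set.range (realizationPoint S (cell a).2)) (fun A _ => by
        obtain ⟨b, hb, hb'⟩ := hcon (A.image cell)
        exact ⟨b, hb, fun a ha => hb' _ (Finset.mem_image_of_mem cell ha)⟩)
    exact ⟨q, hq.1, fun i j h => hq.2 i j h⟩
  have hfin : ∀ (n : ℕ) (x : S _⦋n⦌), {i | q i ∈ Set.range (realizationPoint S x)}.Finite := by
    intro n x
    by_contra hinf
    -- A point of a closed cell is an interior point of one of finitely many faces.
    have key : ∀ i : {i | q i ∈ Set.range (realizationPoint S x)},
        ∃ (f : Σ p : Fin (n + 3), (⦋(p : ℕ)⦌ ⟶ ⦋n⦌))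
          (w : stdSimplex ℝ (Fin ((f.1 : ℕ) + 1))), (∀ a, 0 < w a) ∧
          q i = realizationPoint S (S.map f.2.op x) w := by
      rintro ⟨i, s, hs⟩
      obtain ⟨p, hp, α, w, hw, rfl⟩ := exists_pos_face s
      exact ⟨⟨⟨p, hp⟩, α⟩, w, hw, by rw [← hs, realizationPoint_map]⟩
    choose f w hw hf using key
    have : Infinite {i | q i ∈ Set.range (realizationPoint S x)} := Set.infinite_coe_iff.2 hinf
    obtain ⟨i, j, hij, hfij⟩ := Finite.exists_ne_map_eq_of_infinite f
    wlog hlt : (i : ℕ) < j generalizing i j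
    · exact this j i hij.symm hfij.symm
        (lt_of_le_of_ne (not_lt.1 hlt) fun h => hij (Subtype.ext h.symm))
    have h1 := map_segmentHom_eq ((hrep (q i)).symm.trans (hf i)) (hw i)
    have h2 : S.map (segmentHom (w i) (cutPoints (w i))).op (S.map (f i).2.op x) =
        S.map (f i).2.op x := by
      have : segmentHom (w i) (cutPoints (w i)) = 𝟙 _ := by
        ext a : 3
        exact segmentAt_cutPoint (hw i a)
      rw [this]
      simp
    rw [h2] at h1
    -- Both points lie in the same face of `x`, and this face is the image under a simplicial
    -- operator of the simplex chosen for `q i`. So the cell of `q i` contains `q j`.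
    refine hq i j hlt ?_
    obtain ⟨w', hw'⟩ : ∃ w', q j = realizationPoint S (S.map (f i).2.op x) w' := by
      rw [hfij]
      exact ⟨_, hf j⟩
    rw [hw', ← h1, realizationPoint_map]
    exact Set.mem_range_self _
  have hclosed : ∀ I : Set ℕ, IsClosed (q '' I) := by
    intro I
    refine isClosed_of_realizationPoint fun n x => ?_
    have : realizationPoint S x ⁻¹' (q '' I) =
        ⋃ i ∈ {i | q i ∈ Set.range (realizationPoint S x)} ∩ I,
          realizationPoint S x ⁻¹' {q i} := by
      ext s
      simp only [Set.mem_preimage, Set.mem_image, Set.mem_iUnion, Set.mem_inter_iff,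
        Set.mem_ofPred_eq, Set.mem_singleton_iff, Set.mem_range, exists_prop]
      constructor
      · rintro ⟨i, hi, h⟩
        exact ⟨i, ⟨⟨s, h.symm⟩, hi⟩, h.symm⟩
      · rintro ⟨i, ⟨-, hi⟩, h⟩
        exact ⟨i, hi, h.symm⟩
    rw [this]
    refine ((hfin n x).subset Set.inter_subset_left).isClosed_biUnion fun i _ => ?_
    have h1 := isClosedMap_realizationPoint S (face (q i)) _ (isClosed_singleton (x := coord (q i)))
    rw [Set.image_singleton, ← hrep] at h1
    exact h1.preimage (continuous_realizationPoint S x)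
  have hne : ∀ i j, i < j → q i ≠ q j := fun i j h h' => hq i j h (h' ▸ hcell (q i))
  obtain ⟨z, -, hz⟩ := IsCompact.inter_iInter_nonempty hQ (fun k : ℕ => q '' Set.Ici k)
    (fun k => hclosed _) (fun u => by
      obtain ⟨k, hk⟩ := u.bddAbove
      refine ⟨q k, hqQ k, Set.mem_iInter₂.2 fun i hi => ⟨k, hk hi, rfl⟩⟩)
  rw [Set.mem_iInter] at hz
  obtain ⟨i, -, rfl⟩ := hz 0
  obtain ⟨j, hj, hj'⟩ := hz (i + 1)
  exact hne i j hj hj'.symm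

/-! ### The traversal of a cactus along its lobes -/

namespace Cactus

variable {ι : Type} [Fintype ι]

/-- Radii of the lobes of a cactus and lifts of the collapses to the real line. -/
structure Lifts (c : Cactus ι) where
  r : ι → ℝ
  F : ι → CircleDeg1Lift
  r_pos : ∀ i, 0 < r i
  sum_r : ∑ i, r i = 1
  coe_F : ∀ i (t : ℝ), c.lobe i (t : UnitAddCircle) = ((F i t : ℝ) : UnitAddCircle)
  metric : ∀ s t : ℝ, ∑ i, r i * (F i t - F i s) = t - s

theorem nonempty_lifts (c : Cactus ι) : Nonempty c.Lifts := by
  obtain ⟨r, F, h0, h1, h2, h3⟩ := c.2.metric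
  exact ⟨⟨r, F, h0, h1, h2, h3⟩⟩

namespace Lifts

variable {c : Cactus ι} (L : c.Lifts)

theorem mul_sub_le (k : ι) {s t : ℝ} (h : s ≤ t) : L.r k * (L.F k t - L.F k s) ≤ t - s := by
  rw [← L.metric s t]
  exact Finset.single_le_sum (f := fun i => L.r i * (L.F i t - L.F i s))
    (fun i _ => mul_nonneg (L.r_pos i).le (sub_nonneg.2 ((L.F i).monotone h))) (Finset.mem_univ k)

theorem continuous_F (k : ι) : Continuous (L.F k) := by
  have hr := L.r_pos k
  refine (LipschitzWith.of_le_add_mul (⟨(L.r k)⁻¹, (inv_pos.2 hr).le⟩ : NNReal)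
    fun x y => ?_).continuous
  change L.F k x ≤ L.F k y + (L.r k)⁻¹ * dist x y
  rw [← sub_le_iff_le_add']
  rcases le_total x y with h | h
  · exact (sub_nonpos.2 ((L.F k).monotone h)).trans (by positivity)
  · rw [Real.dist_eq, abs_of_nonneg (sub_nonneg.2 h), inv_mul_eq_div, le_div_iff₀' hr]
    exact L.mul_sub_le k h

theorem F_sub_int (k : ι) (x : ℝ) (n : ℤ) : L.F k (x - n) = L.F k x - n :=
  (L.F k).map_sub_int x n

theorem exists_fiber_eq_Icc (k : ι) (y : ℝ) : ∃ a b, ∀ t, L.F k t = y ↔ t ∈ Set.Icc a b := by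
  obtain ⟨x, hx⟩ : ∃ x, L.F k x = y :=
    (L.F k).continuous_iff_surjective.1 (L.continuous_F k) y
  have hconn : _root_.IsConnected {t | L.F k t = y} := by
    refine ⟨⟨x, hx⟩, Set.OrdConnected.isPreconnected ⟨fun s hs t ht u hu => ?_⟩⟩
    exact le_antisymm (((L.F k).monotone hu.2).trans_eq ht)
      ((Eq.symm hs).trans_le ((L.F k).monotone hu.1))
  have hcomp : IsCompact {t | L.F k t = y} := by
    refine (isCompact_Icc (a := x - 1) (b := x + 1)).of_isClosed_subset
      (isClosed_eq (L.continuous_F k) continuous_const) fun t (ht : L.F k t = y) => ⟨?_, ?_⟩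
    · by_contra! h
      have h1 := (L.F k).monotone (show t + 1 ≤ x by linarith)
      rw [(L.F k).map_add_one] at h1
      linarith
    · by_contra! h
      have h1 := (L.F k).monotone h.le
      rw [(L.F k).map_add_one] at h1
      linarith
  have := eq_Icc_of_connected_compact hconn hcomp
  exact ⟨_, _, fun t => Set.ext_iff.1 this t⟩

variable {m : ℕ} (t : stdSimplex ℝ (Fin (m + 1)))

/-- The traversal moves along the lobe `k` on the `a`-th segment of `t`. -/
def Moves (k : ι) (a : Fin (m + 1)) : Prop :=
  L.F k (cutPoint t a) < L.F k (cutPoint t a + t a)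

/-- The subdivision `t` of the circle is compatible with the point `p` of the lobe `k`: the
interior of a segment on which the traversal moves along the lobe does not meet `p`, and one of
these segments starts at `p`. -/
structure Adapted (k : ι) (p : UnitAddCircle) : Prop where
  ne : ∀ a, L.Moves t k a → ∀ τ ∈ Set.Ioo (cutPoint t a) (cutPoint t a + t a),
    c.lobe k (τ : UnitAddCircle) ≠ p
  start : ∃ a, L.Moves t k a ∧ c.lobe k (cutPoint t a : ℝ) = p

end Lifts

end Cactus

theorem coe_eq_coe_iff {x y : ℝ} :
    (x : UnitAddCircle) = y ↔ ∃ n : ℤ, x = y + n := by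
  rw [← sub_eq_zero, ← AddCircle.coe_sub, AddCircle.coe_eq_zero_iff]
  simp only [zsmul_eq_mul, mul_one]
  exact exists_congr fun n => by rw [eq_comm, sub_eq_iff_eq_add']

theorem IsCut.not_mem_Ioo {m : ℕ} {t : stdSimplex ℝ (Fin (m + 1))} (ht : ∀ a, 0 < t a) {x : ℝ}
    (h : IsCut t x) (a : Fin (m + 1)) : x ∉ Set.Ioo (cutPoint t a) (cutPoint t a + t a) := by
  rintro ⟨h1, h2⟩
  obtain ⟨b, hb⟩ := h
  have hx : cutPoint t b = x := coe_injOn_Ico (cutPoint_mem_Ico (ht b))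
    ⟨(cutPoint_nonneg t a).trans h1.le, h2.trans_le (cutPoint_add_le_one t a)⟩ hb
  rcases le_or_gt b a with h | h
  · linarith [cutPoint_mono t h]
  · linarith [cutPoint_add_le_cutPoint t h]

namespace Cactus.Lifts

variable {ι : Type} [Fintype ι] {c : Cactus ι} (L : c.Lifts)

/-- The traversal rests at the point `p` of a lobe during an arc of the circle. The two
endpoints of this arc are the dividing points that are needed to make a subdivision compatible
with `p`. -/
theorem exists_adapted (k : ι) (p : UnitAddCircle) :
    ∃ z₀ z₁ : UnitAddCircle, ∀ {m : ℕ} (t : stdSimplex ℝ (Fin (m + 1))), (∀ a, 0 < t a) →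
      IsCut t z₀ → IsCut t z₁ → L.Adapted t k p := by
  obtain ⟨y, rfl⟩ := QuotientAddGroup.mk_surjective p
  obtain ⟨a, b, hab⟩ := L.exists_fiber_eq_Icc k y
  refine ⟨a, b, fun {m} t ht ha hb => ⟨fun x hx τ hτ h => ?_, ?_⟩⟩
  · rw [L.coe_F] at h
    obtain ⟨n, hn⟩ := coe_eq_coe_iff.1 h
    have h1 : τ - n ∈ Set.Icc a b := (hab _).1 (by rw [F_sub_int, hn]; ring)
    have ha' : IsCut t ((a + n : ℝ) : UnitAddCircle) := by
      rwa [coe_eq_coe_iff.2 ⟨n, rfl⟩]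
    have hb' : IsCut t ((b + n : ℝ) : UnitAddCircle) := by
      rwa [coe_eq_coe_iff.2 ⟨n, rfl⟩]
    have ha1 := ha'.not_mem_Ioo ht x
    have hb1 := hb'.not_mem_Ioo ht x
    rw [Set.mem_Ioo, not_and_or, not_lt, not_lt] at ha1 hb1
    have ha2 : a + n ≤ cutPoint t x := by
      rcases ha1 with h | h
      · exact h
      · linarith [h1.1, hτ.2]
    have hb2 : cutPoint t x + t x ≤ b + n := by
      rcases hb1 with h | h
      · linarith [h1.2, hτ.1]
      · exact h
    have hx' := ht x
    have e1 : L.F k (cutPoint t x - n) = y := (hab _).2 ⟨by linarith, by linarith⟩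
    have e2 : L.F k (cutPoint t x + t x - n) = y := (hab _).2 ⟨by linarith, by linarith⟩
    rw [F_sub_int] at e1 e2
    have hm : L.F k (cutPoint t x) < L.F k (cutPoint t x + t x) := hx
    linarith
  · obtain ⟨x, hx⟩ := hb
    obtain ⟨n, hn⟩ := coe_eq_coe_iff.1 hx
    have hle : a ≤ b := by
      obtain ⟨w, hw⟩ := (L.F k).continuous_iff_surjective.1 (L.continuous_F k) y
      exact ((hab w).1 hw).1.trans ((hab w).1 hw).2
    have e1 : L.F k (cutPoint t x - n) = y := (hab _).2 (by rw [hn]; simpa using hle)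
    have e2 : L.F k (cutPoint t x + t x - n) ≠ y := fun h => by
      have := ((hab _).1 h).2
      linarith [ht x]
    rw [F_sub_int] at e1 e2
    refine ⟨x, lt_of_le_of_ne ((L.F k).monotone (by linarith [ht x])) fun h => e2 ?_, ?_⟩
    · rw [← h, e1]
    · rw [L.coe_F]
      exact coe_eq_coe_iff.2 ⟨n, by linarith⟩

variable {m : ℕ} {t : stdSimplex ℝ (Fin (m + 1))}

theorem F_end_sub_le_one (k : ι) (a : Fin (m + 1)) :
    L.F k (cutPoint t a + t a) - L.F k (cutPoint t a) ≤ 1 := by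
  have h := (L.F k).monotone (show cutPoint t a + t a ≤ cutPoint t a + 1 by
    linarith [stdSimplex.le_one t a])
  rw [(L.F k).map_add_one] at h
  linarith

theorem F_eq_of_not_moves {k : ι} {a : Fin (m + 1)} (h : ¬ L.Moves t k a) {v : ℝ}
    (hv : v ∈ Set.Icc (0 : ℝ) 1) : L.F k (cutPoint t a + v * t a) = L.F k (cutPoint t a) := by
  have h0 := stdSimplex.zero_le t a
  refine le_antisymm (le_trans ((L.F k).monotone ?_) (not_lt.1 h)) ((L.F k).monotone ?_)
  · nlinarith [hv.2]
  · nlinarith [hv.1]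

/-- Between dividing points that include the branching points of two lobes, the traversal does not
move along both. -/
theorem not_moves_of_moves {k l : ι} {p q : UnitAddCircle}
    (hpq : ∀ z, c.lobe k z = p ∨ c.lobe l z = q) (hA : L.Adapted t k p) {a : Fin (m + 1)}
    (hk : L.Moves t k a) : ¬ L.Moves t l a := by
  intro hl
  have hlt : L.F l (cutPoint t a) < L.F l (cutPoint t a + t a) := hl
  have hle := L.F_end_sub_le_one (t := t) l a
  have key : ∀ w, L.F l (cutPoint t a) < w → w < L.F l (cutPoint t a + t a) →
      (w : UnitAddCircle) = q := fun w h1 h2 => by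
    obtain ⟨τ, hτ, rfl⟩ := intermediate_value_Ioo
      (show cutPoint t a ≤ cutPoint t a + t a by linarith [stdSimplex.zero_le t a])
      (L.continuous_F l).continuousOn ⟨h1, h2⟩
    rw [← L.coe_F]
    exact (hpq τ).resolve_left (hA.ne a hk τ hτ)
  set D := L.F l (cutPoint t a + t a) - L.F l (cutPoint t a) with hD
  have e1 := key (L.F l (cutPoint t a) + D / 3) (by linarith) (by linarith)
  have e2 := key (L.F l (cutPoint t a) + 2 * D / 3) (by linarith) (by linarith)
  obtain ⟨n, hn⟩ := coe_eq_coe_iff.1 (e2.trans e1.symm)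
  have h1 : (0 : ℝ) < n := by linarith
  have h2 : (n : ℝ) < 1 := by linarith
  norm_cast at h1 h2
  omega

/-- If exactly one lobe is moving on the segment `a`, then it has constant speed there. -/
theorem F_eq_of_moves {k : ι} {a : Fin (m + 1)} (h : ∀ l, l ≠ k → ¬ L.Moves t l a) {v : ℝ}
    (hv : v ∈ Set.Icc (0 : ℝ) 1) :
    L.F k (cutPoint t a + v * t a) = L.F k (cutPoint t a) + v * (t a / L.r k) := by
  have h1 := L.metric (cutPoint t a) (cutPoint t a + v * t a)
  rw [Finset.sum_eq_single k (fun l _ hl => by rw [L.F_eq_of_not_moves (h l hl) hv]; simp)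
    (by simp)] at h1
  have := (L.r_pos k).ne'
  field_simp
  linarith

theorem exists_moves (ht : ∀ a, 0 < t a) (a : Fin (m + 1)) : ∃ k, L.Moves t k a := by
  by_contra! hcon
  have h1 := L.metric (cutPoint t a) (cutPoint t a + t a)
  rw [Finset.sum_eq_zero fun l _ => by
    have := L.F_eq_of_not_moves (hcon l) (v := 1) (by simp)
    rw [one_mul] at this
    rw [this]; simp] at h1
  linarith [ht a]

/-- The traversal of a cactus does not visit two lobes alternately. -/
theorem not_alternating {k l : ι} {p q : UnitAddCircle} (ht : ∀ a, 0 < t a)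
    (hpq : ∀ z, c.lobe k z = p ∨ c.lobe l z = q)
    (hmoves : ∀ k l a, L.Moves t k a → l ≠ k → ¬ L.Moves t l a) {x₁ x₂ x₃ x₄ : Fin (m + 1)}
    (h₁₂ : x₁ < x₂) (h₂₃ : x₂ < x₃) (h₃₄ : x₃ < x₄) (h₁ : L.Moves t k x₁) (h₂ : L.Moves t l x₂)
    (h₃ : L.Moves t k x₃) (h₄ : L.Moves t l x₄) : False := by
  -- While the traversal moves along a lobe, it leaves every given point of the lobe.
  have key : ∀ (k : ι) (p : UnitAddCircle) (x : Fin (m + 1)), L.Moves t k x →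
      ∃ τ, cutPoint t x ≤ τ ∧ τ < cutPoint t x + t x ∧ c.lobe k (τ : ℝ) ≠ p := by
    intro k p x hx
    by_contra! hcon
    have hx0 := ht x
    have e1 := hcon (cutPoint t x) le_rfl (by linarith)
    have e2 := hcon (cutPoint t x + 1 / 2 * t x) (by linarith) (by linarith)
    rw [L.coe_F] at e1 e2
    have e3 := L.F_eq_of_moves (fun l hl => hmoves k l x hx hl) (v := 1 / 2) (by norm_num)
    have e4 := L.F_eq_of_moves (fun l hl => hmoves k l x hx hl) (v := 1) (by norm_num)
    obtain ⟨n, hn⟩ := coe_eq_coe_iff.1 (e2.trans e1.symm)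
    have e5 := L.F_end_sub_le_one (t := t) k x
    have e6 : 0 < t x / L.r k := div_pos hx0 (L.r_pos k)
    rw [one_mul] at e4
    have h1 : (0 : ℝ) < n := by linarith
    have h2 : (n : ℝ) < 1 := by linarith
    norm_cast at h1 h2
    omega
  obtain ⟨τ₁, -, u₁, n₁⟩ := key k p x₁ h₁
  obtain ⟨τ₂, l₂, u₂, n₂⟩ := key l q x₂ h₂
  obtain ⟨τ₃, l₃, u₃, n₃⟩ := key k p x₃ h₃
  obtain ⟨τ₄, l₄, u₄, n₄⟩ := key l q x₄ h₄
  obtain ⟨τ₁, l₁, u₁, n₁⟩ := key k p x₁ h₁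
  have i₁₂ := (L.F l).monotone (show τ₁ ≤ τ₂ by linarith [cutPoint_add_le_cutPoint t h₁₂])
  have i₂₃ := (L.F l).monotone (show τ₂ ≤ τ₃ by linarith [cutPoint_add_le_cutPoint t h₂₃])
  have i₃₄ := (L.F l).monotone (show τ₃ ≤ τ₄ by linarith [cutPoint_add_le_cutPoint t h₃₄])
  have i₄₁ := (L.F l).monotone (show τ₄ ≤ τ₁ + 1 by
    linarith [cutPoint_add_le_one t x₄, cutPoint_nonneg t x₁])
  rw [(L.F l).map_add_one] at i₄₁
  -- At the times `τ₁` and `τ₃` the lobe `l` is at `q`, and in between it is not. So it has been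
  -- traversed completely at the time `τ₃`.
  have q₁ := (hpq τ₁).resolve_left n₁
  have q₃ := (hpq τ₃).resolve_left n₃
  rw [L.coe_F] at q₁ q₃ n₂ n₄
  obtain ⟨n, hn⟩ := coe_eq_coe_iff.1 (q₃.trans q₁.symm)
  have hn1 : 1 ≤ n := by
    by_contra! h
    have h' : (n : ℝ) ≤ 0 := by exact_mod_cast Int.lt_add_one_iff.1 h
    exact n₂ (by rw [show L.F l τ₂ = L.F l τ₁ by linarith, q₁])
  have hn1' : (1 : ℝ) ≤ n := by exact_mod_cast hn1
  exact n₄ (by rw [show L.F l τ₄ = L.F l τ₃ by linarith, q₃])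

end Cactus.Lifts

/-! ### Subdividing a cactus -/

/-- Rotations preserve the cyclic order. -/
theorem CyclicLT.add_right {N : ℕ} [NeZero N] {a b c : Fin N} (h : CyclicLT a b c) (d : Fin N) :
    CyclicLT (a + d) (b + d) (c + d) := by
  obtain ⟨a, ha⟩ := a
  obtain ⟨b, hb⟩ := b
  obtain ⟨c, hc⟩ := c
  obtain ⟨d, hd⟩ := d
  simp only [CyclicLT, Fin.lt_def, Fin.val_add_eq_ite] at h ⊢
  split_ifs <;> omega

namespace Cactus.Lifts

variable {ι : Type} [Fintype ι] {c : Cactus ι} (L : c.Lifts) {m : ℕ}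
  {t : stdSimplex ℝ (Fin (m + 1))}

/-- If the dividing points of `t` include what is needed for the distinguished points and the
branching points of the lobes, then `t` cuts the cactus into a spiny cactus. -/
theorem exists_subdivides_of_adapted (ht : ∀ a, 0 < t a) (h0 : ∀ k, L.Adapted t k 0)
    (hP : ∀ k l, k ≠ l → ∃ p q, (∀ z, c.lobe k z = p ∨ c.lobe l z = q) ∧ L.Adapted t k p) :
    ∃ (J : ι → ℕ) (e : SpinyCactus J m) (s : ∀ k, stdSimplex ℝ (Fin (J k + 1))),
      (∀ k i, 0 < s k i) ∧ c.Subdivides e s t ∧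
      ∀ k p, L.Adapted t k p → IsCut (s k) p := by
  classical
  choose κ hκ using L.exists_moves ht
  have hmoves : ∀ k l a, L.Moves t k a → l ≠ k → ¬ L.Moves t l a := fun k l a hk hl => by
    obtain ⟨p, q, hpq, hA⟩ := hP k l hl.symm
    exact L.not_moves_of_moves hpq hA hk
  have hκ_iff : ∀ k a, L.Moves t k a ↔ κ a = k := fun k a =>
    ⟨fun h => by_contra fun hne => hmoves k (κ a) a h hne (hκ a), fun h => h ▸ hκ a⟩
  choose a₀ ha₀ ha₀' using fun k => (h0 k).start
  simp only [hκ_iff] at ha₀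
  -- On lobe `k` the segments are numbered from `a₀ k` on, which starts at the distinguished point.
  let B : ι → Finset (Fin (m + 1)) := fun k => Finset.univ.filter fun j => κ (j + a₀ k) = k
  have hB : ∀ k j, j ∈ B k ↔ κ (j + a₀ k) = k := fun k j => by simp [B]
  have hcard : ∀ k, ∃ n, (B k).card = n + 1 := fun k =>
    Nat.exists_eq_add_one.2 (Finset.card_pos.2 ⟨0, (hB k 0).2 (by rw [zero_add, ha₀])⟩)
  choose J hJ using hcard
  let o : ∀ k, Fin (J k + 1) ↪o Fin (m + 1) := fun k => (B k).orderEmbOfFin (hJ k)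
  have ho : ∀ k i, κ (o k i + a₀ k) = k := fun k i =>
    (hB k _).1 (Finset.orderEmbOfFin_mem (B k) (hJ k) i)
  have ho' : ∀ k j, κ (j + a₀ k) = k → ∃ i, o k i = j := fun k j hj => by
    have : j ∈ Set.range (o k) := by
      rw [Finset.range_orderEmbOfFin]
      exact (hB k j).2 hj
    exact this
  have hbij : Function.Bijective
      fun x : Σ k, Fin (J k + 1) => o x.1 x.2 + a₀ x.1 := by
    constructor
    · rintro ⟨k, i⟩ ⟨l, j⟩ h
      have hkl : k = l := by
        rw [← ho k i, ← ho l j]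
        exact congrArg κ h
      subst hkl
      have : i = j := (o k).injective (add_right_cancel h)
      rw [this]
    · intro a
      obtain ⟨i, hi⟩ := ho' (κ a) (a - a₀ (κ a)) (by rw [sub_add_cancel])
      exact ⟨⟨κ a, i⟩, by simp only [hi, sub_add_cancel]⟩
  let e : SpinyCactus J m :=
    { pos := Equiv.ofBijective _ hbij
      cyclic := fun k a b c hab hbc => CyclicLT.add_right
        (Or.inl ⟨(o k).strictMono hab, (o k).strictMono hbc⟩) (a₀ k)
      noncrossing := by
        intro k l hkl a a' b b' hcross
        have m₁ := (hκ_iff k _).2 (ho k a)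
        have m₂ := (hκ_iff l _).2 (ho l b)
        have m₃ := (hκ_iff k _).2 (ho k a')
        have m₄ := (hκ_iff l _).2 (ho l b')
        obtain ⟨p, q, hpq, -⟩ := hP k l hkl
        have hqp : ∀ z, c.lobe l z = q ∨ c.lobe k z = p := fun z => (hpq z).symm
        simp only [Equiv.ofBijective_apply] at hcross
        obtain ⟨h1 | h1 | h1, h2 | h2 | h2⟩ := hcross
        · exact absurd (h1.1.trans h1.2) (h2.1.trans h2.2).asymm
        · exact L.not_alternating ht hqp hmoves h2.1 h1.1 h1.2 m₄ m₁ m₂ m₃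
        · exact L.not_alternating ht hpq hmoves h1.1 h1.2 h2.2 m₁ m₂ m₃ m₄
        · exact L.not_alternating ht hqp hmoves h1.1 h2.1 h2.2 m₂ m₃ m₄ m₁
        · exact absurd h2.2 h1.2.asymm
        · exact absurd h2.1 h1.2.asymm
        · exact L.not_alternating ht hpq hmoves h2.1 h2.2 h1.2 m₃ m₄ m₁ m₂
        · exact absurd h2.2 h1.1.asymm
        · exact absurd h2.1 h1.1.asymm }
  have hpos : ∀ k i, e.pos ⟨k, i⟩ = o k i + a₀ k := fun _ _ => rfl
  have hslope : ∀ k a (v : ℝ), v ∈ Set.Icc (0 : ℝ) 1 →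
      L.F k (cutPoint t a + v * t a) =
        L.F k (cutPoint t a) + v * (if κ a = k then t a / L.r k else 0) := fun k a v hv => by
    split_ifs with h
    · exact L.F_eq_of_moves (fun l hl => hmoves k l a ((hκ_iff k a).2 h) hl) hv
    · rw [L.F_eq_of_not_moves (fun hm => h ((hκ_iff k a).1 hm)) hv, mul_zero, add_zero]
  have hslope1 : ∀ k a, L.F k (cutPoint t a + t a) =
        L.F k (cutPoint t a) + (if κ a = k then t a / L.r k else 0) := fun k a => by
    simpa using hslope k a 1 (by simp)
  have hmapB : ∀ k, (Finset.univ.map (o k).toEmbedding) = B k := fun k => by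
    ext j
    rw [hB]
    simp only [Finset.mem_map, Finset.mem_univ, true_and]
    exact ⟨fun ⟨i, hi⟩ => hi ▸ ho k i, ho' k j⟩
  have hsum : ∀ k, ∑ i, t (e.pos ⟨k, i⟩) / L.r k = 1 := fun k => by
    have h1 := sum_sub_cutPoint t (L.F k)
    simp only [hslope1, add_sub_cancel_left] at h1
    have h2 : L.F k 1 - L.F k 0 = 1 := by
      have := (L.F k).map_add_one 0
      rw [zero_add] at this
      rw [this]; ring
    rw [← h2, ← h1, ← Equiv.sum_comp (Equiv.addRight (a₀ k)), ← Finset.sum_filter]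
    change _ = ∑ j ∈ B k, _
    rw [← hmapB, Finset.sum_map]
    rfl
  let s : ∀ k, stdSimplex ℝ (Fin (J k + 1)) := fun k =>
    ⟨fun i => t (e.pos ⟨k, i⟩) / L.r k, fun i => (div_pos (ht _) (L.r_pos k)).le, hsum k⟩
  have hs : ∀ k i, s k i = t (e.pos ⟨k, i⟩) / L.r k := fun _ _ => rfl
  -- The position on lobe `k` at a dividing point, as a sum of lengths of segments of the lobe.
  have hcum : ∀ k j, c.lobe k (cutPoint t (j + a₀ k) : ℝ) =
      ((∑ j' ∈ Finset.Iio j, if κ (j' + a₀ k) = k then t (j' + a₀ k) / L.r k else 0 : ℝ) :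
        UnitAddCircle) := fun k j => by
    induction j using Fin.induction with
    | zero =>
      rw [show Finset.Iio (0 : Fin (m + 1)) = ∅ from Finset.Iio_bot, Finset.sum_empty, zero_add,
        ha₀']
      simp
    | succ j ih =>
      have h1 : Finset.Iio j.succ = insert j.castSucc (Finset.Iio j.castSucc) := by
        ext x
        simp only [Finset.mem_Iio, Finset.mem_insert, Fin.lt_def, Fin.ext_iff, Fin.val_succ,
          Fin.val_castSucc]
        omega
      rw [h1, Finset.sum_insert (by simp), ← Fin.coeSucc_eq_succ, add_right_comm,
        coe_cutPoint_add_one, L.coe_F, hslope1, AddCircle.coe_add, ← L.coe_F, ih, add_comm,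
        ← AddCircle.coe_add]
  have hcut : ∀ k i, c.lobe k (cutPoint t (e.pos ⟨k, i⟩) : ℝ) =
      ((cutPoint (s k) i : ℝ) : UnitAddCircle) := fun k i => by
    rw [hpos, hcum, ← Finset.sum_filter, cutPoint]
    congr 1
    have : (Finset.Iio (o k i)).filter (fun j => κ (j + a₀ k) = k) =
        (Finset.Iio i).map (o k).toEmbedding := by
      ext j
      simp only [Finset.mem_filter, Finset.mem_Iio, Finset.mem_map]
      constructor
      · rintro ⟨h1, h2⟩
        obtain ⟨i', rfl⟩ := ho' k j h2
        exact ⟨i', (o k).lt_iff_lt.1 h1, rfl⟩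
      · rintro ⟨i', h1, rfl⟩
        exact ⟨(o k).lt_iff_lt.2 h1, ho k i'⟩
    rw [this, Finset.sum_map]
    rfl
  refine ⟨J, e, s, fun k i => div_pos (ht _) (L.r_pos k), fun k i v hv => ?_, fun k p hA => ?_⟩
  · rw [L.coe_F, hslope k _ v hv, hpos, if_pos (ho k i), AddCircle.coe_add, ← L.coe_F, ← hpos, hcut,
      ← AddCircle.coe_add]
    rfl
  · obtain ⟨a, ha, hap⟩ := hA.start
    obtain ⟨⟨l, i⟩, rfl⟩ := e.pos.surjective a
    rw [hκ_iff, hpos, ho] at ha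
    subst ha
    exact ⟨i, by rw [← hcut, hap]⟩

end Cactus.Lifts

/-- Every subdivision of the circle that is fine enough subdivides a given cactus, and the
lobes are then divided at prescribed points. The number of dividing points that are needed
is bounded independently of the cactus. -/
theorem Cactus.exists_subdivides {ι : Type} [Fintype ι] (c : Cactus ι)
    (P : ι → Finset UnitAddCircle) :
    ∃ B : Finset UnitAddCircle, B.card ≤ ∑ k, 2 * ((P k).card + 1 + Fintype.card ι) ∧
      ∀ {m : ℕ} (t : stdSimplex ℝ (Fin (m + 1))), (∀ a, 0 < t a) → (∀ z ∈ B, IsCut t z) →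
      ∃ (J : ι → ℕ) (e : SpinyCactus J m) (s : ∀ k, stdSimplex ℝ (Fin (J k + 1))),
        (∀ k i, 0 < s k i) ∧ c.Subdivides e s t ∧ ∀ k, ∀ p ∈ P k, IsCut (s k) p := by
  classical
  obtain ⟨L⟩ := c.nonempty_lifts
  have hbranch : ∀ k l, ∃ p q, k ≠ l → ∀ z, c.lobe k z = p ∨ c.lobe l z = q := fun k l => by
    by_cases h : k = l
    · exact ⟨0, 0, fun h' => absurd h h'⟩
    · obtain ⟨p, q, hpq⟩ := c.2.tree k l h
      exact ⟨p, q, fun _ => hpq⟩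
  choose p q hpq using hbranch
  choose z₀ z₁ hz using L.exists_adapted
  let Q : ι → Finset UnitAddCircle := fun k => insert 0 (P k) ∪ Finset.univ.image (p k)
  have hQ : ∀ k, (Q k).card ≤ (P k).card + 1 + Fintype.card ι := fun k =>
    (Finset.card_union_le _ _).trans
      (add_le_add (Finset.card_insert_le _ _) Finset.card_image_le)
  let B : Finset UnitAddCircle := Finset.univ.biUnion fun k =>
    (Q k).image (z₀ k) ∪ (Q k).image (z₁ k)
  have hB : B.card ≤ ∑ k, 2 * ((P k).card + 1 + Fintype.card ι) := by
    refine Finset.card_biUnion_le.trans (Finset.sum_le_sum fun k _ => ?_)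
    refine (Finset.card_union_le _ _).trans ?_
    have h0 : ((Q k).image (z₀ k)).card ≤ (Q k).card := Finset.card_image_le
    have h1 : ((Q k).image (z₁ k)).card ≤ (Q k).card := Finset.card_image_le
    have := hQ k
    omega
  refine ⟨B, hB, fun {m} t ht hcut => ?_⟩
  have hA : ∀ k, ∀ x ∈ Q k, L.Adapted t k x := fun k x hx =>
    hz k x t ht
      (hcut _ (Finset.mem_biUnion.2 ⟨k, Finset.mem_univ k,
        Finset.mem_union_left _ (Finset.mem_image_of_mem _ hx)⟩))
      (hcut _ (Finset.mem_biUnion.2 ⟨k, Finset.mem_univ k,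
        Finset.mem_union_right _ (Finset.mem_image_of_mem _ hx)⟩))
  obtain ⟨J, e, s, hs, hsub, hc⟩ := L.exists_subdivides_of_adapted ht
    (fun k => hA k 0 (by simp [Q])) fun k l hkl => ⟨p k l, q k l, hpq k l hkl, hA k _ (by simp [Q])⟩
  exact ⟨J, e, s, hs, hsub, fun k x hx => hc k x (hA k x (by simp [Q, hx]))⟩

/-! ### Refining a subdivision of a cactus -/

namespace Cactus.Subdivides

variable {ι : Type} [Fintype ι] {c : Cactus ι} {J J' : ι → ℕ} {m m' : ℕ}
  {e : SpinyCactus J m} {s : ∀ k, stdSimplex ℝ (Fin (J k + 1))} {t : stdSimplex ℝ (Fin (m + 1))}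
  {e' : SpinyCactus J' m'} {s' : ∀ k, stdSimplex ℝ (Fin (J' k + 1))}
  {t' : stdSimplex ℝ (Fin (m' + 1))}

/-- The relation `Subdivides` holds on the level of lifts: two lifts of the same path with the same
initial point agree. -/
theorem F_eq (h : c.Subdivides e s t) (L : c.Lifts) (k : ι) (i : Fin (J k + 1)) {v : ℝ}
    (hv : v ∈ Set.Icc (0 : ℝ) 1) :
    L.F k (cutPoint t (e.pos ⟨k, i⟩) + v * t (e.pos ⟨k, i⟩)) =
      L.F k (cutPoint t (e.pos ⟨k, i⟩)) + v * s k i := by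
  set g : ℝ → ℝ := fun v => L.F k (cutPoint t (e.pos ⟨k, i⟩) + v * t (e.pos ⟨k, i⟩)) -
      L.F k (cutPoint t (e.pos ⟨k, i⟩)) - v * s k i with hg
  have hcont : Continuous g := by
    have := L.continuous_F k
    fun_prop
  have hint : ∀ w ∈ Set.Icc (0 : ℝ) 1, ∃ n : ℤ, g w = n := fun w hw => by
    have h1 := h k i w hw
    have h2 := h k i 0 (by simp)
    rw [zero_mul, zero_mul, add_zero, add_zero, L.coe_F] at h2
    rw [L.coe_F, AddCircle.coe_add, ← h2, ← AddCircle.coe_add] at h1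
    obtain ⟨n, hn⟩ := coe_eq_coe_iff.1 h1
    exact ⟨n, by rw [hg]; linarith⟩
  have h0 : g 0 = 0 := by simp [hg]
  have hzero : g v = 0 := by
    obtain ⟨n, hn⟩ := hint v hv
    have hivt := intermediate_value_uIcc (hcont.continuousOn (s := Set.uIcc 0 v))
    rw [h0, hn] at hivt
    have key : ∀ w : ℝ, w ∈ Set.uIcc (0 : ℝ) n → ∃ n' : ℤ, w = n' := fun w hw => by
      obtain ⟨x, hx, rfl⟩ := hivt hw
      rw [Set.uIcc_of_le hv.1] at hx
      exact hint x ⟨hx.1, hx.2.trans hv.2⟩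
    rw [hn]
    rcases lt_trichotomy n 0 with hlt | rfl | hgt
    · have hle : (n : ℝ) ≤ -1 := by exact_mod_cast Int.le_sub_one_of_lt hlt
      obtain ⟨n', hn'⟩ := key (-1 / 2) (Set.mem_uIcc.2 (Or.inr ⟨by linarith, by norm_num⟩))
      have h1 : (n' : ℝ) < 0 := by linarith
      have h2 : (-1 : ℝ) < n' := by linarith
      norm_cast at h1 h2
      omega
    · simp
    · have hle : (1 : ℝ) ≤ n := by exact_mod_cast Int.add_one_le_of_lt hgt
      obtain ⟨n', hn'⟩ := key (1 / 2) (Set.mem_uIcc.2 (Or.inl ⟨by norm_num, by linarith⟩))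
      have h1 : (0 : ℝ) < n' := by linarith
      have h2 : (n' : ℝ) < 1 := by linarith
      norm_cast at h1 h2
      omega
  rw [hg] at hzero
  linarith

theorem F_end (h : c.Subdivides e s t) (L : c.Lifts) (k : ι) (i : Fin (J k + 1)) :
    L.F k (cutPoint t (e.pos ⟨k, i⟩) + t (e.pos ⟨k, i⟩)) =
      L.F k (cutPoint t (e.pos ⟨k, i⟩)) + s k i := by
  simpa using h.F_eq L k i (v := 1) (by simp)

/-- The segments of the lobe `l` account for a complete turn around `l`, so that the traversal
rests on `l` during all the other segments. -/
theorem not_moves (h : c.Subdivides e s t) (L : c.Lifts) {k l : ι} (hkl : k ≠ l)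
    (i : Fin (J k + 1)) : ¬ L.Moves t l (e.pos ⟨k, i⟩) := by
  classical
  let f : (Σ k, Fin (J k + 1)) → ℝ := fun x =>
    L.F l (cutPoint t (e.pos x) + t (e.pos x)) - L.F l (cutPoint t (e.pos x))
  let g : (Σ k, Fin (J k + 1)) → ℝ := fun x => if x.1 = l then f x else 0
  have hf0 : ∀ x, 0 ≤ f x := fun x => sub_nonneg.2 ((L.F l).monotone (by
    linarith [stdSimplex.zero_le t (e.pos x)]))
  have hgf : ∀ x ∈ Finset.univ, g x ≤ f x := fun x _ => by
    simp only [g]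
    split_ifs
    exacts [le_rfl, hf0 x]
  have hf : ∑ x, f x = 1 := by
    have h1 := sum_sub_cutPoint t (L.F l)
    rw [← e.pos.sum_comp] at h1
    have h2 := (L.F l).map_add_one 0
    rw [zero_add] at h2
    change ∑ x, (L.F l (cutPoint t (e.pos x) + t (e.pos x)) - L.F l (cutPoint t (e.pos x))) = 1
    rw [h1, h2]
    ring
  have hg : ∑ x, g x = 1 := by
    rw [Fintype.sum_sigma, Finset.sum_eq_single l]
    · simp only [g, f, if_true, h.F_end L, add_sub_cancel_left]
      exact stdSimplex.sum_eq_one (s l)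
    · intro k' _ hk'
      exact Finset.sum_eq_zero fun i _ => if_neg hk'
    · simp
  have := (Finset.sum_eq_sum_iff_of_le hgf).1 (hg.trans hf.symm) ⟨k, i⟩ (Finset.mem_univ _)
  simp only [g, f, if_neg hkl] at this
  simp only [Lifts.Moves]
  linarith

/-- The length of a segment on the circle is the radius of its lobe times its length on the lobe. -/
theorem mul_eq (h : c.Subdivides e s t) (L : c.Lifts) (k : ι) (i : Fin (J k + 1)) :
    L.r k * s k i = t (e.pos ⟨k, i⟩) := by
  have h1 := L.metric (cutPoint t (e.pos ⟨k, i⟩)) (cutPoint t (e.pos ⟨k, i⟩) + t (e.pos ⟨k, i⟩))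
  rw [Finset.sum_eq_single k, h.F_end L] at h1
  · linarith
  · intro l _ hl
    have := L.F_eq_of_not_moves (h.not_moves L hl.symm i) (v := 1) (by simp)
    rw [one_mul] at this
    rw [this]
    simp
  · simp

/-- Every segment of a subdivision of a cactus into segments of positive lengths starts
within a segment of any other subdivision, at the same relative position on the circle and on the
lobe. -/
theorem exists_position (h : c.Subdivides e s t) (h' : c.Subdivides e' s' t')
    (ht' : ∀ a, 0 < t' a) (hs' : ∀ k i, 0 < s' k i) (k : ι) (i : Fin (J' k + 1)) :
    ∃ (j : Fin (J k + 1)) (v : ℝ), v ∈ Set.Ico (0 : ℝ) 1 ∧ 0 < t (e.pos ⟨k, j⟩) ∧ 0 < s k j ∧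
      cutPoint t' (e'.pos ⟨k, i⟩) = cutPoint t (e.pos ⟨k, j⟩) + v * t (e.pos ⟨k, j⟩) ∧
      cutPoint (s' k) i = cutPoint (s k) j + v * s k j := by
  obtain ⟨L⟩ := c.nonempty_lifts
  set x := e'.pos ⟨k, i⟩ with hx
  have hτ := cutPoint_mem_Ico (ht' x)
  have h1 := cutPoint_segmentAt_le t hτ.1
  have h2 := lt_cutPoint_segmentAt_add t hτ.2
  obtain ⟨⟨l, j⟩, hlj⟩ := e.pos.surjective (segmentAt t (cutPoint t' x))
  rw [← hlj] at h1 h2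
  set a := e.pos ⟨l, j⟩ with ha
  have hta : 0 < t a := by linarith
  have hlk : l = k := by
    by_contra hne
    have hrest := h.not_moves L hne j
    rw [← ha, Lifts.Moves, not_lt] at hrest
    -- The lobe `k` moves at the beginning of the segment `x` of `t'`, inside the segment `a`.
    have hu0 : 0 < min 1 ((cutPoint t a + t a - cutPoint t' x) / t' x) :=
      lt_min one_pos (div_pos (by linarith) (ht' x))
    have hu1 := h'.F_eq L k i ⟨hu0.le, min_le_left _ _⟩
    rw [← hx] at hu1
    have hu2 : min 1 ((cutPoint t a + t a - cutPoint t' x) / t' x) * t' x ≤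
        cutPoint t a + t a - cutPoint t' x := by
      rw [← le_div_iff₀ (ht' x)]
      exact min_le_right _ _
    have hu3 := (L.F k).monotone (show cutPoint t' x +
      min 1 ((cutPoint t a + t a - cutPoint t' x) / t' x) * t' x ≤ cutPoint t a + t a by linarith)
    have hu4 := (L.F k).monotone h1
    have hu5 := mul_pos hu0 (hs' k i)
    linarith
  subst hlk
  have hsj : 0 < s l j := by
    have := h.mul_eq L l j
    rw [← ha] at this
    exact pos_of_mul_pos_right (this ▸ hta) (L.r_pos l).le
  set v := (cutPoint t' x - cutPoint t a) / t a with hv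
  have hv0 : 0 ≤ v := div_nonneg (by linarith) hta.le
  have hv1 : v < 1 := by rw [hv, div_lt_one hta]; linarith
  have hτv : cutPoint t' x = cutPoint t a + v * t a := by
    rw [hv, div_mul_cancel₀ _ hta.ne']
    ring
  refine ⟨j, v, ⟨hv0, hv1⟩, hta, hsj, hτv, ?_⟩
  have e1 := h l j v ⟨hv0, hv1.le⟩
  have e2 := h' l i 0 (by simp)
  rw [zero_mul, zero_mul, add_zero, add_zero, ← hx, hτv, e1] at e2
  refine (coe_injOn_Ico ⟨?_, ?_⟩ (cutPoint_mem_Ico (hs' l i)) e2).symm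
  · have := cutPoint_nonneg (s l) j
    positivity
  · have := cutPoint_add_le_one (s l) j
    nlinarith

end Cactus.Subdivides

/-- The structure maps of a cactus set for two subdivisions of the same cactus, one of which
refines the other one, give the same point of the realization. -/
theorem CactusSet.realizationPoint_μ_eq_of_refines (S : CactusSet.{u}) {ι : Type} [Fintype ι]
    {c : Cactus ι} {J J' : ι → ℕ} {m m' : ℕ} {e : SpinyCactus J m}
    {s : ∀ k, stdSimplex ℝ (Fin (J k + 1))} {t : stdSimplex ℝ (Fin (m + 1))}
    {e' : SpinyCactus J' m'} {s' : ∀ k, stdSimplex ℝ (Fin (J' k + 1))}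
    {t' : stdSimplex ℝ (Fin (m' + 1))} (h : c.Subdivides e s t) (h' : c.Subdivides e' s' t')
    (ht' : ∀ a, 0 < t' a) (hs' : ∀ k i, 0 < s' k i)
    (hcut : ∀ a, IsCut t' (cutPoint t a : ℝ)) (x : ∀ k, S.toSSet _⦋J k⦌) :
    realizationPoint S.toSSet (S.μ e x) t = realizationPoint S.toSSet
      (S.μ e' fun k => S.toSSet.map (segmentHom (s k) (cutPoints (s' k))).op (x k)) t' := by
  rw [S.μ_map e e' (fun k => segmentHom (s k) (cutPoints (s' k))) (segmentHom t (cutPoints t')),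
    realizationPoint_map, map_segmentHom_cutPoints ht' hcut]
  · intro k i
    obtain ⟨j, v, hv, htj, hsj, h1, h2⟩ := h.exists_position h' ht' hs' k i
    have e1 : segmentAt t (cutPoint t' (e'.pos ⟨k, i⟩)) = e.pos ⟨k, j⟩ :=
      segmentAt_eq (by rw [h1]; nlinarith [hv.1]) (by rw [h1]; nlinarith [hv.2])
    have e2 : segmentAt (s k) (cutPoint (s' k) i) = j :=
      segmentAt_eq (by rw [h2]; nlinarith [hv.1]) (by rw [h2]; nlinarith [hv.2])
    exact e1.trans (by rw [← e2]; rfl)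
  · intro k i i' hii' hθ
    obtain ⟨j, v, hv, htj, hsj, h1, h2⟩ := h.exists_position h' ht' hs' k i
    obtain ⟨j', v', hv', htj', hsj', h1', h2'⟩ := h.exists_position h' ht' hs' k i'
    have e2 : segmentAt (s k) (cutPoint (s' k) i) = j :=
      segmentAt_eq (by rw [h2]; nlinarith [hv.1]) (by rw [h2]; nlinarith [hv.2])
    have e2' : segmentAt (s k) (cutPoint (s' k) i') = j' :=
      segmentAt_eq (by rw [h2']; nlinarith [hv'.1]) (by rw [h2']; nlinarith [hv'.2])
    have hjj' : j = j' := e2.symm.trans (Eq.trans hθ e2')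
    subst hjj'
    have hlt := cutPoint_strictMono (hs' k) hii'
    rw [h2, h2', add_lt_add_iff_left, mul_lt_mul_iff_left₀ hsj] at hlt
    rw [← (cutPoint_strictMono ht').lt_iff_lt, h1, h1']
    nlinarith

/-- The point of the realization given by a subdivision of a cactus depends only on the cactus and
on the points of the realization to which it is applied. -/
theorem CactusSet.realizationPoint_μ_eq (S : CactusSet.{u}) {ι : Type} [Fintype ι]
    {c : Cactus ι} {J J' : ι → ℕ} {m m' : ℕ} {e : SpinyCactus J m}
    {s : ∀ k, stdSimplex ℝ (Fin (J k + 1))} {t : stdSimplex ℝ (Fin (m + 1))}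
    {e' : SpinyCactus J' m'} {s' : ∀ k, stdSimplex ℝ (Fin (J' k + 1))}
    {t' : stdSimplex ℝ (Fin (m' + 1))} (h : c.Subdivides e s t) (h' : c.Subdivides e' s' t')
    {x : ∀ k, S.toSSet _⦋J k⦌} {x' : ∀ k, S.toSSet _⦋J' k⦌}
    (hx : ∀ k, realizationPoint S.toSSet (x k) (s k) = realizationPoint S.toSSet (x' k) (s' k)) :
    realizationPoint S.toSSet (S.μ e x) t = realizationPoint S.toSSet (S.μ e' x') t' := by
  classical
  obtain ⟨B, -, hB⟩ := c.exists_subdivides fun _ => ∅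
  obtain ⟨p, w, -, hw, hc⟩ := exists_isCut
    (B ∪ (Finset.univ.image (fun a => ((cutPoint t a : ℝ) : UnitAddCircle)) ∪
      Finset.univ.image (fun a => ((cutPoint t' a : ℝ) : UnitAddCircle))))
  obtain ⟨K, f, q, hq, hsub, -⟩ := hB w hw fun z hz => hc z (Finset.mem_union_left _ hz)
  rw [S.realizationPoint_μ_eq_of_refines h hsub hw hq fun a => hc _ (by simp),
    S.realizationPoint_μ_eq_of_refines h' hsub hw hq fun a => hc _ (by simp)]
  congr 2
  ext k
  exact map_segmentHom_eq (hx k) (hq k)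

/-! ### The action of the cactus operad -/

/-- Every subdivision of the circle that is fine enough gives a representation of the given points
by a subdivision of the cactus. -/
theorem Cactus.exists_representation {S : SSet.{u}} {ι : Type} [Fintype ι] (c : Cactus ι)
    (x : ι → |S|) :
    ∃ B : Finset UnitAddCircle, ∀ {m : ℕ} (t : stdSimplex ℝ (Fin (m + 1))), (∀ a, 0 < t a) →
      (∀ z ∈ B, IsCut t z) →
      ∃ (J : ι → ℕ) (e : SpinyCactus J m) (s : ∀ k, stdSimplex ℝ (Fin (J k + 1)))
        (y : ∀ k, S _⦋J k⦌), c.Subdivides e s t ∧ ∀ k, x k = realizationPoint S (y k) (s k) := by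
  classical
  choose n y σ hσ using fun k => exists_eq_realizationPoint (x k)
  obtain ⟨B, -, hB⟩ := c.exists_subdivides fun k =>
    Finset.univ.image (fun a => ((cutPoint (σ k) a : ℝ) : UnitAddCircle))
  refine ⟨B, fun {m} t ht hcut => ?_⟩
  obtain ⟨J, e, s, hs, hsub, hc⟩ := hB t ht hcut
  refine ⟨J, e, s, fun k => S.map (segmentHom (σ k) (cutPoints (s k))).op (y k), hsub, fun k => ?_⟩
  rw [realizationPoint_map, map_segmentHom_cutPoints (hs k) fun a => hc k _ (by simp), hσ]

/-- There is a point that all subdivisions of `c` assign to the tuple `x`. -/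
theorem CactusSet.exists_act (S : CactusSet.{u}) {ι : Type} [Fintype ι] (c : Cactus ι)
    (x : ι → |S.toSSet|) :
    ∃ z : |S.toSSet|, ∀ {J : ι → ℕ} {m : ℕ} (e : SpinyCactus J m)
      (s : ∀ k, stdSimplex ℝ (Fin (J k + 1))) (t : stdSimplex ℝ (Fin (m + 1))),
      c.Subdivides e s t → ∀ y : ∀ k, S.toSSet _⦋J k⦌,
      (∀ k, x k = realizationPoint S.toSSet (y k) (s k)) →
      z = realizationPoint S.toSSet (S.μ e y) t := by
  obtain ⟨B, hB⟩ := c.exists_representation x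
  obtain ⟨m, t, -, ht, hcut⟩ := exists_isCut B
  obtain ⟨J, e, s, y, h, hx⟩ := hB t ht hcut
  exact ⟨realizationPoint S.toSSet (S.μ e y) t, fun e' s' t' h' y' hx' =>
    S.realizationPoint_μ_eq h h' fun k => (hx k).symm.trans (hx' k)⟩

/-- The action of a cactus on the realization of a cactus set: the point `[μ e y, t]` for any
subdivision of the cactus and any representation of the tuple `x` by simplices `y`. -/
noncomputable def CactusSet.act (S : CactusSet.{u}) {ι : Type} [Fintype ι] (c : Cactus ι)
    (x : ι → |S.toSSet|) : |S.toSSet| :=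
  (S.exists_act c x).choose

theorem CactusSet.act_realizationPoint (S : CactusSet.{u}) {ι : Type} [Fintype ι] {c : Cactus ι}
    {J : ι → ℕ} {m : ℕ} {e : SpinyCactus J m} {s : ∀ k, stdSimplex ℝ (Fin (J k + 1))}
    {t : stdSimplex ℝ (Fin (m + 1))} (h : c.Subdivides e s t) (x : ∀ k, S.toSSet _⦋J k⦌) :
    S.act c (fun k => realizationPoint S.toSSet (x k) (s k)) =
      realizationPoint S.toSSet (S.μ e x) t :=
  (S.exists_act c _).choose_spec e s t h x fun _ => rfl

/-- All tuples of points of the realization are of the form to which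
`CactusSet.act_realizationPoint` applies. -/
theorem Cactus.exists_subdivides_realizationPoint {S : SSet.{u}} {ι : Type} [Fintype ι]
    (c : Cactus ι) (x : ι → |S|) :
    ∃ (J : ι → ℕ) (m : ℕ) (e : SpinyCactus J m) (s : ∀ k, stdSimplex ℝ (Fin (J k + 1)))
      (t : stdSimplex ℝ (Fin (m + 1))) (y : ∀ k, S _⦋J k⦌), c.Subdivides e s t ∧
      x = fun k => realizationPoint S (y k) (s k) := by
  obtain ⟨B, hB⟩ := c.exists_representation x
  obtain ⟨m, t, -, ht, hcut⟩ := exists_isCut B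
  obtain ⟨J, e, s, y, h, hx⟩ := hB t ht hcut
  exact ⟨J, m, e, s, t, y, h, funext hx⟩

theorem CactusSet.inducedByStructureMaps_iff (S : CactusSet.{u}) {ι : Type} [Fintype ι]
    (a : Cactus ι → (ι → |S.toSSet|) → |S.toSSet|) :
    InducedByStructureMaps S a ↔ a = S.act := by
  constructor
  · intro h
    ext c x
    obtain ⟨J, m, e, s, t, y, hsub, rfl⟩ := c.exists_subdivides_realizationPoint x
    rw [h c e s t hsub, S.act_realizationPoint hsub]
  · rintro rfl
    exact fun c J m e s t hsub x => S.act_realizationPoint hsub x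

theorem CactusSet.act_one (S : CactusSet.{u}) (x : |S.toSSet|) :
    S.act Cactus.one (fun _ => x) = x := by
  obtain ⟨n, y, s, rfl⟩ := exists_eq_realizationPoint x
  have h : Cactus.one.Subdivides (SpinyCactus.one n) (fun _ => s) s := fun _ _ _ _ => rfl
  rw [S.act_realizationPoint h fun _ => y, S.μ_one]

theorem CactusSet.act_reindex (S : CactusSet.{u}) {ι κ : Type} [Fintype ι] [Fintype κ]
    (c : Cactus κ) (σ : ι ≃ κ) (x : κ → |S.toSSet|) :
    S.act (c.reindex σ) (fun i => x (σ i)) = S.act c x := by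
  obtain ⟨J, m, e, s, t, y, h, rfl⟩ := c.exists_subdivides_realizationPoint x
  have h' : (c.reindex σ).Subdivides (e.reindex σ) (fun i => s (σ i)) t :=
    fun i j v hv => h (σ i) j v hv
  rw [S.act_realizationPoint h, S.act_realizationPoint h' fun i => y (σ i), S.μ_reindex]

theorem CactusSet.act_comp (S : CactusSet.{u}) {ι : Type} [Fintype ι] {κ : ι → Type}
    [∀ i, Fintype (κ i)] (c : Cactus ι) (d : ∀ i, Cactus (κ i)) (x : (Σ i, κ i) → |S.toSSet|) :
    S.act (c.comp d) x = S.act c (fun i => S.act (d i) (fun l => x ⟨i, l⟩)) := by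
  choose B hB using fun i => (d i).exists_representation fun l => x ⟨i, l⟩
  -- The lobes of `c` have to be subdivided so finely that they subdivide the cacti `d i`.
  obtain ⟨A, -, hA⟩ := c.exists_subdivides B
  obtain ⟨m, t, -, ht, hcut⟩ := exists_isCut A
  obtain ⟨J, e, s, hs, h, hsB⟩ := hA t ht hcut
  choose R f q y hf hx using fun i => hB i (s i) (hs i) (hsB i)
  have hx' : x = fun p => realizationPoint S.toSSet (y p.1 p.2) (q p.1 p.2) :=
    funext fun p => hx p.1 p.2
  have hcomp : (c.comp d).Subdivides (e.comp f) (fun p => q p.1 p.2) t := by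
    rintro ⟨i, l⟩ j v hv
    exact (congrArg ((d i).lobe l) (h i ((f i).pos ⟨l, j⟩) v hv)).trans (hf i l j v hv)
  rw [hx', S.act_realizationPoint hcomp fun p => y p.1 p.2, S.μ_comp]
  simp only [S.act_realizationPoint (hf _)]
  rw [S.act_realizationPoint h]

theorem CactusSet.Hom.map_act {S T : CactusSet.{u}} (f : S.Hom T) {ι : Type} [Fintype ι]
    (c : Cactus ι) (x : ι → |S.toSSet|) :
    SSet.toTop.map f.map (S.act c x) = T.act c (fun i => SSet.toTop.map f.map (x i)) := by
  obtain ⟨J, m, e, s, t, y, h, rfl⟩ := c.exists_subdivides_realizationPoint x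
  simp only [S.act_realizationPoint h, toTop_map_realizationPoint, T.act_realizationPoint h,
    f.map_μ]

/-! ### Continuity of the action -/

/-- Finitely many closed maps that are jointly surjective form a quotient map. -/
theorem continuous_of_isClosedMap_cover {α X Y : Type*} [Finite α] [TopologicalSpace X]
    [TopologicalSpace Y] {W : α → Type*} [∀ a, TopologicalSpace (W a)] (p : ∀ a, W a → X)
    (hp : ∀ a, IsClosedMap (p a)) (hsurj : ∀ x, ∃ a w, p a w = x) {F : X → Y}
    (hF : ∀ a, Continuous fun w => F (p a w)) : Continuous F := by
  refine continuous_iff_isClosed.2 fun C hC => ?_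
  have : F ⁻¹' C = ⋃ a, p a '' ((fun w => F (p a w)) ⁻¹' C) := by
    ext x
    simp only [Set.mem_preimage, Set.mem_iUnion, Set.mem_image]
    constructor
    · intro hx
      obtain ⟨a, w, rfl⟩ := hsurj x
      exact ⟨a, w, hx, rfl⟩
    · rintro ⟨a, w, hw, rfl⟩
      exact hw
  rw [this]
  exact isClosed_iUnion_of_finite fun a => hp a _ (hC.preimage (hF a))

instance {ι : Type} [Finite ι] {J : ι → ℕ} {m : ℕ} : Finite (SpinyCactus J m) :=
  Finite.of_injective (fun e : SpinyCactus J m => (e.pos : (Σ k, Fin (J k + 1)) → Fin (m + 1)))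
    fun e e' h => by
      cases e
      cases e'
      congr
      exact Equiv.coe_fn_injective h

theorem SpinyCactus.le_of_lobe {ι : Type} {J : ι → ℕ} {m : ℕ} (e : SpinyCactus J m) (k : ι) :
    J k ≤ m := by
  have h := Fintype.card_le_of_injective (fun i : Fin (J k + 1) => e.pos ⟨k, i⟩) fun i j h => by
    simpa using e.pos.injective h
  simpa using h

theorem Cactus.continuous_lobe_apply {X : Type*} {κ : Type} [Fintype κ] [TopologicalSpace X]
    {c : X → Cactus κ} (hc : Continuous c) {z : X → UnitAddCircle} (hz : Continuous z) (k : κ) :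
    Continuous fun x => (c x).lobe k (z x) := by
  have : Continuous fun x => (c x).lobe k :=
    (continuous_apply k).comp (continuous_subtype_val.comp hc)
  exact this.eval hz

theorem Cactus.isClosed_subdivides {ι : Type} [Fintype ι] {J : ι → ℕ} {m : ℕ}
    (e : SpinyCactus J m) :
    IsClosed (Set.ofPred fun q : Cactus ι × (∀ k, stdSimplex ℝ (Fin (J k + 1))) ×
      stdSimplex ℝ (Fin (m + 1)) => q.1.Subdivides e q.2.1 q.2.2) := by
  have hcoord : ∀ {n : ℕ} (a : Fin (n + 1)),
      Continuous fun t : stdSimplex ℝ (Fin (n + 1)) => t a := fun a =>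
    (continuous_apply a).comp continuous_subtype_val
  have hpoint : ∀ {n : ℕ} (a : Fin (n + 1)) (v : ℝ),
      Continuous fun t : stdSimplex ℝ (Fin (n + 1)) =>
        ((cutPoint t a + v * t a : ℝ) : UnitAddCircle) := fun a v =>
    (AddCircle.continuous_mk' 1).comp
      ((continuous_cutPoint a).add (continuous_const.mul (hcoord a)))
  simp only [Cactus.Subdivides, Set.ofPred_forall]
  refine isClosed_iInter fun k => isClosed_iInter fun i => isClosed_iInter fun v =>
    isClosed_iInter fun _ => ?_
  exact isClosed_eq
    (Cactus.continuous_lobe_apply continuous_fst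
      ((hpoint (e.pos ⟨k, i⟩) v).comp (continuous_snd.comp continuous_snd)) k)
    ((hpoint i v).comp ((continuous_apply k).comp (continuous_fst.comp continuous_snd)))

/-- On fixed simplices the action is continuous: there are finitely many possible combinatorial
types of subdivisions, for each of which the action is given by a structure map. -/
theorem CactusSet.continuous_act_realizationPoint (S : CactusSet.{u}) {ι : Type} [Fintype ι]
    {n : ι → ℕ} (y : ∀ k, S.toSSet _⦋n k⦌) :
    Continuous fun q : Cactus ι × (∀ k, stdSimplex ℝ (Fin (n k + 1))) =>
      S.act q.1 fun k => realizationPoint S.toSSet (y k) (q.2 k) := by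
  classical
  let N : ℕ := (∑ k, 2 * (n k + 1 + 1 + Fintype.card ι)) + 1
  let W : (Σ (J : ι → Fin N) (m : Fin N), SpinyCactus (fun k => (J k : ℕ)) m ×
      (∀ k, (⦋(J k : ℕ)⦌ : SimplexCategory) ⟶ ⦋n k⦌)) → Type := fun a =>
    {q : Cactus ι × (∀ k, stdSimplex ℝ (Fin ((a.1 k : ℕ) + 1))) ×
      stdSimplex ℝ (Fin ((a.2.1 : ℕ) + 1)) // q.1.Subdivides a.2.2.1 q.2.1 q.2.2}
  let p : ∀ a, W a → Cactus ι × (∀ k, stdSimplex ℝ (Fin (n k + 1))) := fun a q =>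
    (q.1.1, fun k => stdSimplex.map (a.2.2.2 k) (q.1.2.1 k))
  let _ : ∀ a, TopologicalSpace (W a) := fun a => instTopologicalSpaceSubtype
  refine continuous_of_isClosedMap_cover (W := W) p (fun a => ?_) ?_ fun a => ?_
  · refine IsClosedMap.comp (g := fun q : Cactus ι × (∀ k, stdSimplex ℝ (Fin ((a.1 k : ℕ) + 1))) ×
      stdSimplex ℝ (Fin ((a.2.1 : ℕ) + 1)) =>
        ((q.1, fun k => stdSimplex.map (a.2.2.2 k) (q.2.1 k)) :
          Cactus ι × (∀ k, stdSimplex ℝ (Fin (n k + 1))))) ?_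
      (Cactus.isClosed_subdivides a.2.2.1).isClosedMap_subtype_val
    have h1 : Continuous fun q : (∀ k, stdSimplex ℝ (Fin ((a.1 k : ℕ) + 1))) ×
        stdSimplex ℝ (Fin ((a.2.1 : ℕ) + 1)) =>
        (fun k => stdSimplex.map (a.2.2.2 k) (q.1 k) : ∀ k, stdSimplex ℝ (Fin (n k + 1))) :=
      continuous_pi fun k => (stdSimplex.continuous_map _).comp
        ((continuous_apply k).comp continuous_fst)
    exact (isProperMap_id.prodMap h1.isProperMap).isClosedMap
  · rintro ⟨c, σ⟩
    obtain ⟨B, hBc, hB⟩ := c.exists_subdivides fun k =>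
      Finset.univ.image (fun a => ((cutPoint (σ k) a : ℝ) : UnitAddCircle))
    obtain ⟨m, t, hm, ht, hcut⟩ := exists_isCut B
    obtain ⟨J, e, s, hs, hsub, hc⟩ := hB t ht hcut
    have hmN : m < N := by
      refine Nat.lt_succ_of_le (hm.trans (hBc.trans (Finset.sum_le_sum fun k _ => ?_)))
      have h1 : (Finset.univ.image
          (fun a => ((cutPoint (σ k) a : ℝ) : UnitAddCircle))).card ≤ n k + 1 :=
        Finset.card_image_le.trans (by simp)
      omega
    refine ⟨⟨fun k => ⟨J k, (e.le_of_lobe k).trans_lt hmN⟩, ⟨m, hmN⟩, e,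
      fun k => segmentHom (σ k) (cutPoints (s k))⟩, ⟨(c, s, t), hsub⟩, ?_⟩
    refine Prod.ext rfl (funext fun k => ?_)
    exact map_segmentHom_cutPoints (hs k) fun a => hc k _ (by simp)
  · have h1 : ∀ q : W a, S.act (p a q).1 (fun k => realizationPoint S.toSSet (y k) ((p a q).2 k)) =
        realizationPoint S.toSSet
          (S.μ a.2.2.1 fun k => S.toSSet.map (a.2.2.2 k).op (y k)) q.1.2.2 := fun q => by
      rw [← S.act_realizationPoint q.2]
      simp only [realizationPoint_map]
      rfl
    simp only [h1]
    exact (continuous_realizationPoint _ _).comp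
      (continuous_snd.comp (continuous_snd.comp continuous_subtype_val))

/-- A map from a compact space to a power of the realization lifts, after a finite covering by
closed maps, to products of simplices. -/
theorem CactusSet.continuous_act (S : CactusSet.{u}) {ι : Type} [Fintype ι] :
    Continuous[TopologicalSpace.compactlyGenerated.{u} (Cactus ι × (ι → |S.toSSet|)),
      inferInstance] (fun p : Cactus ι × (ι → |S.toSSet|) => S.act p.1 p.2) := by
  refine continuous_from_compactlyGenerated _ fun K g => ?_
  have hg : ∀ i, Continuous fun k => (g k).2 i := fun i =>
    (continuous_apply i).comp (continuous_snd.comp g.continuous)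
  choose A hA using fun i => exists_finite_cells (isCompact_range (hg i))
  let P : ∀ a : (∀ i, A i), (∀ i, stdSimplex ℝ (Fin ((a i).1.1 + 1))) → (ι → |S.toSSet|) :=
    fun a s i => realizationPoint S.toSSet (a i).1.2 (s i)
  let W : (∀ i, A i) → Type u := fun a =>
    {q : K × (∀ i, stdSimplex ℝ (Fin ((a i).1.1 + 1))) // (g q.1).2 = P a q.2}
  let _ : ∀ a, TopologicalSpace (W a) := fun a => instTopologicalSpaceSubtype
  refine continuous_of_isClosedMap_cover (W := W) (fun a q => q.1.1) (fun a C hC => ?_)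
    (fun k => ?_) fun a => ?_
  · -- The map `W a → K` is a base change of a product of proper maps.
    obtain ⟨C', hC', rfl⟩ := isClosed_induced_iff.1 hC
    have hP : IsProperMap (Prod.map (id : K → K) (P a)) :=
      isProperMap_id.prodMap (.pi_map fun i => isProperMap_realizationPoint _ _)
    have h1 : (fun q : W a => q.1.1) '' (Subtype.val ⁻¹' C') =
        (fun k => (k, (g k).2)) ⁻¹' (Prod.map (id : K → K) (P a) '' C') := by
      ext k
      simp only [Set.mem_image, Set.mem_preimage, Prod.exists, Prod.map_apply, id, Prod.mk.injEq]
      constructor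
      · rintro ⟨⟨⟨k', s⟩, h⟩, hq, rfl⟩
        exact ⟨k', s, hq, rfl, h.symm⟩
      · rintro ⟨k', s, hq, rfl, h⟩
        exact ⟨⟨⟨k', s⟩, h.symm⟩, hq, rfl⟩
    rw [h1]
    exact (hP.isClosedMap _ hC').preimage
      (continuous_id.prodMk (continuous_snd.comp g.continuous))
  · choose y hy s hs using fun i => hA i _ (Set.mem_range_self k)
    exact ⟨fun i => ⟨y i, hy i⟩, ⟨(k, s), funext fun i => (hs i).symm⟩, rfl⟩
  · have h1 : ∀ q : W a, S.act (g q.1.1).1 (g q.1.1).2 = S.act (g q.1.1).1 (P a q.1.2) :=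
      fun q => by rw [q.2]
    refine Continuous.congr ?_ fun q => (h1 q).symm
    exact (S.continuous_act_realizationPoint fun i => (a i).1.2).comp
      ((continuous_fst.comp (g.continuous.comp (continuous_fst.comp continuous_subtype_val))).prodMk
        (continuous_snd.comp continuous_subtype_val))

/-- The realization of a cactus set as an algebra over the cactus operad. -/
noncomputable def CactusSet.algebra (S : CactusSet.{u}) : CactusAlgebra |S.toSSet| where
  act := S.act
  continuous_act := S.continuous_act
  act_comp := S.act_comp
  act_one := S.act_one
  act_reindex := S.act_reindex

theorem mainTheorem2 :
    ∃ A : ∀ S : CactusSet.{u}, CactusAlgebra |S.toSSet|,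
      (∀ (S : CactusSet.{u}) (ι : Type) [Fintype ι]
        (a : Cactus ι → (ι → |S.toSSet|) → |S.toSSet|),
        InducedByStructureMaps S a ↔ a = (A S).act) ∧
      ∀ (S T : CactusSet.{u}) (f : S.Hom T) (ι : Type) [Fintype ι] (c : Cactus ι)
        (x : ι → |S.toSSet|),
        SSet.toTop.map f.map ((A S).act c x) =
          (A T).act c (fun i => SSet.toTop.map f.map (x i)) :=
  ⟨CactusSet.algebra, fun S _ _ a => S.inducedByStructureMaps_iff a,
    fun _ _ f _ _ c x => f.map_act c x⟩
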